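/- Let $\mathbf a$ be an essentially small preadditive category. Write $\mathsf{PSh}\,\mathbf a$ for the category of additive functors $\mathbf a^{\mathrm{op}}\to\mathsf{Ab}$ and $\mathtt Y:\mathbf a\to\mathsf{PSh}\,\mathbf a$ for the Yoneda embedding $X\mapsto\mathbf a(-,X)$. An (additive) sieve on $X\in\mathbf a$ is an additive subfunctor $R\subset\mathbf a(-,X)$. A Grothendieck topology $\mathcal T$ on $\mathbf a$ assigns to each $X$ a set $\mathcal T(X)$ of sieves on $X$ such that: $\mathbf a(-,X)\in\mathcal T(X)$; if $R\in\mathcal T(X)$ and $f:Y\to X$, then $f^{-1}R\in\mathcal T(Y)$; and if $R\in\mathcal T(X)$ and $S$ is a sieve on $X$ with $f^{-1}S\in\mathcal T(Y)$ for all $Y$ and all $f\in R(Y)$, then $S\in\mathcal T(X)$. The category $\mathsf{Sh}(\mathbf a,\mathcal T)$ is the full subcategory of those $F\in\mathsf{PSh}\,\mathbf a$ for which $\mathrm{Hom}(\mathbf a(-,X),F)\to\mathrm{Hom}(R,F)$ is bijective for all $X$ and all $R\in\mathcal T(X)$; sheafification $\mathtt S:\mathsf{PSh}\,\mathbf a\to\mathsf{Sh}(\mathbf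 a,\mathcal T)$ is the left adjoint of the inclusion, and $\mathtt Z=\mathtt S\circ\mathtt Y$. An AB3 category is an abelian category with all small colimits. Let $\mathcal{AB}_3$ be the 2-category of AB3 categories, with faithful exact functors that preserve small colimits as 1-morphisms and all natural transformations as 2-morphisms. An additive functor $\theta:\mathbf a\to\mathbf C$ to an AB3 category is prexact if its (additive) left Kan extension along $\mathtt Y$, i.e. the (up to isomorphism unique) functor $\Theta:\mathsf{PSh}\,\mathbf a\to\mathbf C$ that preserves small colimits and satisfies $\Theta\circ\mathtt Y\simeq\theta$, is left exact. Its topology $\mathcal T_\theta$ consists of the sieves $R\subset\mathbf a(-,X)$ that contain a small family of morphisms $Y_\beta\to X$ for which $\bigoplus_\beta\theta(Y_\beta)\to\theta(X)$ is an epimorphism. For a Grothendieck topology $\mathcal T$, let $[\mathbf a,\mathbf C]_{prex,\mathcal T}$ be the category of prexact functors $\theta:\mathbf a\to\mathbf C$ with $\mathcal T_\theta=\mathcal T$ and all natural transformations; composition makes $[\mathbf a,-]_{prex,\mathcal T}$ a 2-functor $\mathcal{AB}_3\to\mathcal Cat$. **Theorem.** For each Grothendieck topology $\mathcal T$ on $\mathbf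 a$, the 2-functor $[\mathbf a,-]_{prex,\mathcal T}:\mathcal{AB}_3\to\mathcal Cat$ is represented by $\mathsf{Sh}(\mathbf a,\mathcal T)$, with universal object $\mathtt Z$. That is: $\mathsf{Sh}(\mathbf a,\mathcal T)$ is an AB3 category, sheafification exists, $\mathtt Z$ is prexact with $\mathcal T_{\mathtt Z}=\mathcal T$, and for every AB3 category $\mathbf C$ composition with $\mathtt Z$ is an equivalence $$\mathcal{AB}_3(\mathsf{Sh}(\mathbf a,\mathcal T),\mathbf C)\;\stackrel{\sim}{\to}\;[\mathbf a,\mathbf C]_{prex,\mathcal T},\qquad F\mapsto F\circ\mathtt Z.$$ -/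

import Mathlib

open CategoryTheory CategoryTheory.Limits Opposite

universe v u w₁' w₁ w₂' w₂

noncomputable section

namespace AdditiveSheaf

section Presheaves

variable (a : Type u) [Category.{v} a] [Preadditive a]

/-- The category of additive presheaves of abelian groups on a preadditive category. -/
abbrev PSh := aᵒᵖ ⥤+ AddCommGrpCat.{v}

/-- The additive Yoneda embedding `X ↦ a(-, X)`. -/
def yonedaPSh : a ⥤ PSh a :=
  ObjectProperty.lift _ preadditiveYoneda fun X =>
    (inferInstance : (preadditiveYoneda.obj X).Additive)

variable {a}

/-- An additive sieve on `X`: an additive subfunctor of `a(-, X)`, that is, a family of subgroups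
of the groups `a(Y, X)` which is stable under precomposition. -/
structure AdditiveSieve (X : a) where
  /-- The subgroup of `a(Y, X)` of the morphisms which belong to the sieve. -/
  homs (Y : a) : AddSubgroup (Y ⟶ X)
  comp_mem {Y Z : a} {f : Y ⟶ X} (hf : f ∈ homs Y) (g : Z ⟶ Y) : g ≫ f ∈ homs Z

namespace AdditiveSieve

/-- The maximal sieve `a(-, X)`. -/
def top (X : a) : AdditiveSieve X where
  homs _ := ⊤
  comp_mem _ _ := AddSubgroup.mem_top _

/-- The inverse image of a sieve on `X` under `f : Y ⟶ X`, made of the `g` with `f ∘ g ∈ R`. -/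
def pullback {X Y : a} (R : AdditiveSieve X) (f : Y ⟶ X) : AdditiveSieve Y where
  homs Z := (R.homs Z).comap (Preadditive.rightComp Z f)
  comp_mem {Z W g} hg h := by
    have hg' : g ≫ f ∈ R.homs Z := hg
    change (h ≫ g) ≫ f ∈ R.homs W
    rw [Category.assoc]
    exact R.comp_mem hg' h

/-- An additive sieve, seen as an additive presheaf. -/
def toPSh {X : a} (R : AdditiveSieve X) : PSh a where
  obj :=
    { obj := fun Y => AddCommGrpCat.of (R.homs Y.unop)
      map := fun {Y Z} g => AddCommGrpCat.ofHom
        { toFun := fun f => ⟨g.unop ≫ f.1, R.comp_mem f.2 g.unop⟩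
          map_zero' := Subtype.ext (by simp)
          map_add' := fun _ _ => Subtype.ext (by simp) }
      map_id := fun _ => by
        ext f
        exact Category.id_comp f.1
      map_comp := fun g h => by
        ext f
        exact Category.assoc h.unop g.unop f.1 }
  property := by
    constructor
    intro Y Z g h
    ext f
    exact Preadditive.add_comp _ _ _ g.unop h.unop f.1

/-- The inclusion of a sieve on `X` into the representable presheaf `a(-, X)`. -/
def incl {X : a} (R : AdditiveSieve X) : R.toPSh ⟶ (yonedaPSh a).obj X :=
  ObjectProperty.homMk
    { app := fun Y => AddCommGrpCat.ofHom (R.homs Y.unop).subtype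
      naturality := fun _ _ _ => rfl }

end AdditiveSieve

end Presheaves

/-- An additive Grothendieck topology on a preadditive category. -/
structure AdditiveTopology (a : Type u) [Category.{v} a] [Preadditive a] where
  /-- The covering sieves on `X`. -/
  covers (X : a) : Set (AdditiveSieve X)
  top_mem (X : a) : AdditiveSieve.top X ∈ covers X
  pullback_mem {X Y : a} {R : AdditiveSieve X} (hR : R ∈ covers X) (f : Y ⟶ X) :
    R.pullback f ∈ covers Y
  transitive {X : a} {R : AdditiveSieve X} (hR : R ∈ covers X) (S : AdditiveSieve X)
    (hS : ∀ (Y : a) (f : Y ⟶ X), f ∈ R.homs Y → S.pullback f ∈ covers Y) : S ∈ covers X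

section Sheaves

variable {a : Type u} [Category.{v} a] [Preadditive a] (T : AdditiveTopology a)

/-- An additive presheaf `F` is a `T`-sheaf if, for every covering sieve `R` on `X`, each morphism
`R ⟶ F` extends uniquely to `a(-, X)`. -/
def IsSheaf : ObjectProperty (PSh a) := fun F =>
  ∀ (X : a) (R : AdditiveSieve X), R ∈ T.covers X →
    Function.Bijective fun φ : (yonedaPSh a).obj X ⟶ F => R.incl ≫ φ

/-- The category `Sh(a, T)` of `T`-sheaves: a full subcategory of `PSh a`. -/
abbrev Sh := (IsSheaf T).FullSubcategory

/-- The inclusion of sheaves into additive presheaves. -/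
abbrev shInclusion : Sh T ⥤ PSh a := (IsSheaf T).ι

/-- Sheafification: the left adjoint of the inclusion of sheaves into presheaves. -/
def sheafification [(shInclusion T).IsRightAdjoint] : PSh a ⥤ Sh T :=
  (shInclusion T).leftAdjoint

/-- The canonical functor `Z : a ⥤ Sh(a, T)`, the sheafified Yoneda embedding. -/
def yonedaSh [(shInclusion T).IsRightAdjoint] : a ⥤ Sh T := yonedaPSh a ⋙ sheafification T

end Sheaves

section Prexact

variable {a : Type u} [Category.{v} a] [Preadditive a]
  {C : Type w₁} [Category.{w₁'} C] [Preadditive C]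
  {D : Type w₂} [Category.{w₂'} D] [Preadditive D]

/-- `Θ : PSh a ⥤ C` is the (additive) left Kan extension of `θ : a ⥤ C` along the Yoneda
embedding: the functor, unique up to isomorphism, which preserves small colimits and restricts
to `θ`. -/
structure IsYonedaExtension (θ : a ⥤ C) (Θ : PSh a ⥤ C) : Prop where
  cocontinuous : PreservesColimitsOfSize.{v, v} Θ
  restricts : Nonempty (yonedaPSh a ⋙ Θ ≅ θ)

/-- An additive functor is prexact if its left Kan extension to presheaves is (left) exact. -/
structure IsPrexact (θ : a ⥤ C) : Prop where
  additive : θ.Additive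
  exact_extension : ∃ Θ : PSh a ⥤ C, IsYonedaExtension θ Θ ∧ PreservesFiniteLimits Θ

/-- The covering system of a prexact functor `θ`: a sieve `R` on `X` is covering if it contains
a small family of morphisms `Y i ⟶ X` for which `⨁ θ (Y i) ⟶ θ X` is an epimorphism. -/
def inducedCovers [HasColimitsOfSize.{v, v} C] (θ : a ⥤ C) (X : a) : Set (AdditiveSieve X) :=
  {R | ∃ (ι : Type v) (Y : ι → a) (f : ∀ i, Y i ⟶ X), (∀ i, f i ∈ R.homs (Y i)) ∧
    Epi (Sigma.desc fun i => θ.map (f i) : (∐ fun i => θ.obj (Y i)) ⟶ θ.obj X)}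

/-- The prexact functors `a ⥤ C` whose induced topology is `T`. -/
def prexactWithTopology (T : AdditiveTopology a) (C : Type w₁) [Category.{w₁'} C] [Preadditive C]
    [HasColimitsOfSize.{v, v} C] : ObjectProperty (a ⥤ C) := fun θ =>
  IsPrexact θ ∧ ∀ X : a, inducedCovers θ X = T.covers X

/-- The category `[a, C]_{prex, T}` of prexact functors with induced topology `T`, and all natural
transformations. -/
abbrev PrexFunctor (T : AdditiveTopology a) (C : Type w₁) [Category.{w₁'} C] [Preadditive C]
    [HasColimitsOfSize.{v, v} C] := (prexactWithTopology T C).FullSubcategory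

end Prexact

section AB3

/-- Faithful exact functors which preserve small (`v`-small) colimits. -/
structure IsFaithfulExactCocontinuous {C : Type w₁} [Category.{w₁'} C] {D : Type w₂}
    [Category.{w₂'} D] (F : C ⥤ D) : Prop where
  faithful : F.Faithful
  leftExact : PreservesFiniteLimits F
  rightExact : PreservesFiniteColimits F
  cocontinuous : PreservesColimitsOfSize.{v, v} F

/-- The category of faithful exact cocontinuous functors `C ⥤ D` and all natural
transformations: the category of 1-morphisms of the 2-category of AB3 categories. -/
abbrev AB3Functor (C : Type w₁) [Category.{w₁'} C] (D : Type w₂) [Category.{w₂'} D] :=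
  ObjectProperty.FullSubcategory
    (fun F : C ⥤ D => IsFaithfulExactCocontinuous.{v} F)

variable {a : Type u} [Category.{v} a] [Preadditive a] (T : AdditiveTopology a)
  {C : Type w₁} [Category.{w₁'} C] [Preadditive C] [HasColimitsOfSize.{v, v} C]
  {D : Type w₂} [Category.{w₂'} D] [Preadditive D] [HasColimitsOfSize.{v, v} D]

lemma IsFaithfulExactCocontinuous.additive {F : C ⥤ D}
    (hF : IsFaithfulExactCocontinuous.{v} F) : F.Additive := by
  have hF' := hF.rightExact
  have hC : HasFiniteColimits C := hasFiniteColimits_of_hasColimitsOfSize.{v, v} C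
  have hD : HasFiniteColimits D := hasFiniteColimits_of_hasColimitsOfSize.{v, v} D
  have : HasBinaryBiproducts C := HasBinaryBiproducts.of_hasBinaryCoproducts
  have : HasZeroObject C := hasZeroObject_of_hasInitial_object
  have : HasZeroObject D := hasZeroObject_of_hasInitial_object
  exact rightExactFunctor_le_additiveFunctor C D F hF'

lemma inducedCovers_comp {F : C ⥤ D} (hF : IsFaithfulExactCocontinuous.{v} F) (θ : a ⥤ C)
    (X : a) : inducedCovers (θ ⋙ F) X = inducedCovers θ X := by
  have := hF.faithful
  have := hF.rightExact
  have := hF.cocontinuous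
  ext R
  refine exists_congr fun ι => exists_congr fun Y => exists_congr fun f =>
    and_congr_right fun _ => ?_
  have h : (Sigma.desc fun i => (θ ⋙ F).map (f i) :
      (∐ fun i => (θ ⋙ F).obj (Y i)) ⟶ (θ ⋙ F).obj X) =
      (sigmaComparison F fun i => θ.obj (Y i)) ≫ F.map (Sigma.desc fun i => θ.map (f i)) := by
    apply Sigma.hom_ext
    intro i
    simp
  rw [h, epi_comp_iff_of_epi]
  exact ⟨fun _ => F.epi_of_epi_map ‹_›, fun _ => inferInstance⟩

lemma prexactWithTopology_comp {θ : a ⥤ C} (hθ : prexactWithTopology T C θ) {F : C ⥤ D}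
    (hF : IsFaithfulExactCocontinuous.{v} F) : prexactWithTopology T D (θ ⋙ F) := by
  obtain ⟨⟨_, Θ, ⟨_, ⟨e⟩⟩, _⟩, h⟩ := hθ
  have := hF.additive
  have := hF.cocontinuous
  have := hF.leftExact
  refine ⟨⟨inferInstance, Θ ⋙ F, ⟨inferInstance, ⟨?_⟩⟩, inferInstance⟩, fun X => ?_⟩
  · exact (Functor.associator _ _ _).symm ≪≫ Functor.isoWhiskerRight e F
  · rw [inducedCovers_comp hF, h]

/-- The action of the 2-functor `[a, -]_{prex, T}` on 1-morphisms and 2-morphisms: a faithful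
exact cocontinuous `F : C ⥤ D` acts by `θ ↦ F ∘ θ`, and natural transformations act by
whiskering. -/
def prexPostcomp (C : Type w₁) [Category.{w₁'} C] [Preadditive C] [HasColimitsOfSize.{v, v} C]
    (D : Type w₂) [Category.{w₂'} D] [Preadditive D] [HasColimitsOfSize.{v, v} D] :
    AB3Functor.{v} C D ⥤ PrexFunctor T C ⥤ PrexFunctor T D where
  obj F :=
    { obj := fun θ => ⟨θ.obj ⋙ F.obj, prexactWithTopology_comp T θ.property F.property⟩
      map := fun η => ObjectProperty.homMk (Functor.whiskerRight η.hom F.obj) }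
  map α :=
    { app := fun θ => ObjectProperty.homMk (Functor.whiskerLeft θ.obj α.hom) }

end AB3

end AdditiveSheaf

end

open AdditiveSheaf

/-! Call a morphism of presheaves bicovering if its kernel is locally zero and it is locally
surjective. A sheaf cannot tell the source of a bicovering morphism from its target
(`IsBicovering.hom_ext`, `IsBicovering.exists_desc`), and each presheaf has a bicovering morphism to
a sheaf (`exists_isBicovering_isSheaf`). Hence sheafification exists and its unit is bicovering; its
left exactness and the equality of the topology of `Z` with `T` (`inducedCovers_yonedaSh`) become
local statements about sections.

Let `Θ` be an exact extension of a prexact `θ` with topology `T`. Covering sieves go to jointly epic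
families under `θ`, so `Θ` inverts bicovering morphisms (`isIso_map_of_isBicovering`), in particular
the units. Thus `Θ` is sheafification followed by the restriction of `Θ` to sheaves, and this
restriction is exact and cocontinuous. It is faithful because, conversely, every sieve that `θ` sees
as covering lies in `T`: a section killed by `Θ` vanishes locally
(`sieve_mem_covers_of_map_ofSec_eq_zero`). This gives essential surjectivity.

For 2-morphisms, sheafification is a localization, and a natural transformation out of a
cocontinuous functor on presheaves is the same as its restriction to representables
(`natTrans_ext_of_yoneda`, `exists_natTrans_extension`). -/

noncomputable section

namespace AdditiveSheaf

/-! ### Limits and colimits of additive functors -/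

section Additive

variable {C : Type*} [Category* C] [Preadditive C] {D : Type*} [Category* D] [Preadditive D]

/-- Colimits of functors are pointwise, and the coprojections detect the equation that expresses
additivity. -/
instance additiveFunctor_isClosedUnderColimitsOfShape (J : Type*) [Category* J]
    [HasColimitsOfShape J D] : (additiveFunctor C D).IsClosedUnderColimitsOfShape J where
  colimitsOfShape_le := by
    rintro F ⟨h⟩
    have hF : ∀ X, IsColimit (((evaluation C D).obj X).mapCocone h.cocone) := fun X =>
      isColimitOfPreserves _ h.isColimit
    refine ⟨fun {X Y f g} => (hF X).hom_ext fun j => ?_⟩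
    have := h.prop_diag_obj j
    rw [additiveFunctor_iff] at this
    change (h.ι.app j).app X ≫ F.map (f + g) = (h.ι.app j).app X ≫ (F.map f + F.map g)
    simp [← NatTrans.naturality, Preadditive.comp_add]

instance additiveFunctor_isClosedUnderLimitsOfShape (J : Type*) [Category* J]
    [HasLimitsOfShape J D] : (additiveFunctor C D).IsClosedUnderLimitsOfShape J where
  limitsOfShape_le := by
    rintro F ⟨h⟩
    have hF : ∀ X, IsLimit (((evaluation C D).obj X).mapCone h.cone) := fun X =>
      isLimitOfPreserves _ h.isLimit
    refine ⟨fun {X Y f g} => (hF Y).hom_ext fun j => ?_⟩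
    have := h.prop_diag_obj j
    rw [additiveFunctor_iff] at this
    change F.map (f + g) ≫ (h.π.app j).app Y = (F.map f + F.map g) ≫ (h.π.app j).app Y
    simp [Preadditive.add_comp]

end Additive

/-! ### Sections of additive presheaves and the Yoneda lemma -/

section Presheaves

variable (a : Type u) [Category.{v} a] [Preadditive a]

instance : HasColimitsOfSize.{v, v} (PSh a) := ⟨fun _ _ => inferInstance⟩

instance : HasLimitsOfSize.{v, v} (PSh a) := ⟨fun _ _ => inferInstance⟩

open scoped ZeroObject in
instance : (additiveFunctor aᵒᵖ AddCommGrpCat.{v}).ContainsZero :=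
  ⟨0, isZero_zero _,
    ⟨fun {X _ _ _} => ((Functor.isZero_iff _).1 (isZero_zero _) X).eq_of_src _ _⟩⟩

instance : (additiveFunctor aᵒᵖ AddCommGrpCat.{v}).IsClosedUnderFiniteProducts :=
  ⟨fun _ _ => inferInstance⟩

instance : (additiveFunctor aᵒᵖ AddCommGrpCat.{v}).IsClosedUnderKernels where
  kernels_le := by
    rintro _ ⟨f, k, hk, hf⟩
    exact ObjectProperty.prop_of_isLimit _ hk (by rintro (_ | _); exacts [hf.1, hf.2])

instance : (additiveFunctor aᵒᵖ AddCommGrpCat.{v}).IsClosedUnderCokernels where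
  cokernels_le := by
    rintro _ ⟨f, k, hk, hf⟩
    exact ObjectProperty.prop_of_isColimit _ hk (by rintro (_ | _); exacts [hf.1, hf.2])

instance : Abelian (PSh a) := inferInstance

variable {a}

/-- The group of sections of an additive presheaf over `X`. -/
abbrev PSh.sec (F : PSh a) (X : a) : AddCommGrpCat.{v} := F.obj.obj (op X)

/-- The restriction of sections along `f : Y ⟶ X`. -/
def PSh.res (F : PSh a) {X Y : a} (f : Y ⟶ X) : F.sec X →+ F.sec Y := (F.obj.map f.op).hom

/-- The map induced on sections by a morphism of additive presheaves. -/
def PSh.app {F G : PSh a} (α : F ⟶ G) (X : a) : F.sec X →+ G.sec X := (α.hom.app (op X)).hom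

namespace PSh

lemma res_id (F : PSh a) {X : a} (x : F.sec X) : F.res (𝟙 X) x = x := by
  simp [res]

lemma res_res (F : PSh a) {X Y Z : a} (f : Y ⟶ X) (g : Z ⟶ Y) (x : F.sec X) :
    F.res g (F.res f x) = F.res (g ≫ f) x := by
  simp [res]

lemma res_zero_hom (F : PSh a) {X : a} (Y : a) (x : F.sec X) : F.res (0 : Y ⟶ X) x = 0 := by
  simp [res]

lemma res_add_hom (F : PSh a) {X Y : a} (f g : Y ⟶ X) (x : F.sec X) :
    F.res (f + g) x = F.res f x + F.res g x := by
  simp [res, Functor.map_add]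

lemma res_neg_hom (F : PSh a) {X Y : a} (f : Y ⟶ X) (x : F.sec X) :
    F.res (-f) x = -F.res f x := by
  simp [res, Functor.map_neg]

lemma app_res {F G : PSh a} (α : F ⟶ G) {X Y : a} (f : Y ⟶ X) (x : F.sec X) :
    app α Y (F.res f x) = G.res f (app α X x) :=
  ConcreteCategory.congr_hom (α.hom.naturality f.op) x

@[simp]
lemma app_comp {F G H : PSh a} (α : F ⟶ G) (β : G ⟶ H) {X : a} (x : F.sec X) :
    app (α ≫ β) X x = app β X (app α X x) := rfl

@[simp]
lemma app_id {F : PSh a} {X : a} (x : F.sec X) : app (𝟙 F) X x = x := rfl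

@[simp]
lemma app_zero {F G : PSh a} {X : a} (x : F.sec X) : app (0 : F ⟶ G) X x = 0 := rfl

lemma hom_ext {F G : PSh a} {α β : F ⟶ G} (h : ∀ (X : a) (x : F.sec X), app α X x = app β X x) :
    α = β := by
  ext X x
  exact h X.unop x

/-- A morphism of additive presheaves from its action on sections. -/
def homMk {F G : PSh a} (φ : ∀ X, F.sec X →+ G.sec X)
    (hφ : ∀ {X Y : a} (f : Y ⟶ X) (x : F.sec X), φ Y (F.res f x) = G.res f (φ X x)) : F ⟶ G :=
  ObjectProperty.homMk
    { app := fun X => AddCommGrpCat.ofHom (φ X.unop)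
      naturality := fun X Y f => by
        ext x
        exact hφ f.unop x }

/-- An additive presheaf from its groups of sections and its restriction maps. -/
def ofSections (A : a → Type v) [∀ X, AddCommGroup (A X)]
    (r : ∀ {X Y : a}, (Y ⟶ X) → (A X →+ A Y)) (r_id : ∀ (X : a) (x : A X), r (𝟙 X) x = x)
    (r_comp : ∀ {X Y Z : a} (f : Y ⟶ X) (g : Z ⟶ Y) (x : A X), r (g ≫ f) x = r g (r f x))
    (r_add : ∀ {X Y : a} (f g : Y ⟶ X) (x : A X), r (f + g) x = r f x + r g x) : PSh a where
  obj :=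
    { obj := fun X => AddCommGrpCat.of (A X.unop)
      map := fun f => AddCommGrpCat.ofHom (r f.unop)
      map_id := fun X => by
        ext x
        exact r_id X.unop x
      map_comp := fun f g => by
        ext x
        exact r_comp f.unop g.unop x }
  property := by
    constructor
    intro X Y f g
    ext x
    exact r_add f.unop g.unop x

/-- The morphism `a(-, X) ⟶ F` which corresponds to a section of `F` over `X`. -/
def ofSec {F : PSh a} {X : a} (x : F.sec X) : (yonedaPSh a).obj X ⟶ F :=
  homMk (F := (yonedaPSh a).obj X)
    (fun _ => { toFun := fun f => F.res f x
                map_zero' := F.res_zero_hom _ x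
                map_add' := fun f g => F.res_add_hom f g x })
    (fun f g => (F.res_res g f x).symm)

/-- The section which corresponds to a morphism `a(-, X) ⟶ F`. -/
def toSec {F : PSh a} {X : a} (φ : (yonedaPSh a).obj X ⟶ F) : F.sec X := app φ X (𝟙 X)

lemma app_eq_res_toSec {F : PSh a} {X Y : a} (φ : (yonedaPSh a).obj X ⟶ F) (f : Y ⟶ X) :
    app φ Y f = F.res f (toSec φ) :=
  (congrArg (app φ Y) (Category.comp_id f).symm).trans
    (app_res φ f (show ((yonedaPSh a).obj X).sec X from 𝟙 X))

@[simp]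
lemma toSec_ofSec {F : PSh a} {X : a} (x : F.sec X) : toSec (ofSec x) = x := F.res_id x

@[simp]
lemma ofSec_toSec {F : PSh a} {X : a} (φ : (yonedaPSh a).obj X ⟶ F) : ofSec (toSec φ) = φ :=
  hom_ext fun _ f => (app_eq_res_toSec φ f).symm

@[simp]
lemma toSec_comp {F G : PSh a} {X : a} (φ : (yonedaPSh a).obj X ⟶ F) (α : F ⟶ G) :
    toSec (φ ≫ α) = app α X (toSec φ) := rfl

lemma ofSec_comp {F G : PSh a} {X : a} (x : F.sec X) (α : F ⟶ G) :
    ofSec x ≫ α = ofSec (app α X x) :=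
  hom_ext fun _ f => app_res α f x

lemma map_comp_ofSec {F : PSh a} {X Y : a} (f : Y ⟶ X) (x : F.sec X) :
    (yonedaPSh a).map f ≫ ofSec x = ofSec (F.res f x) :=
  hom_ext fun _ g => (F.res_res f g x).symm

lemma yonedaPSh_map_toSec {X Y : a} (φ : (yonedaPSh a).obj Y ⟶ (yonedaPSh a).obj X) :
    (yonedaPSh a).map (toSec φ) = φ :=
  hom_ext fun _ g => (app_eq_res_toSec φ g).symm

lemma ofSec_injective {F : PSh a} {X : a} : Function.Injective (ofSec : F.sec X → _) :=
  Function.LeftInverse.injective toSec_ofSec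

lemma ofSec_add {F : PSh a} {X : a} (x y : F.sec X) : ofSec (x + y) = ofSec x + ofSec y :=
  hom_ext fun _ f => (F.res f).map_add x y

lemma ofSec_neg {F : PSh a} {X : a} (x : F.sec X) : ofSec (-x) = -ofSec x :=
  hom_ext fun _ f => (F.res f).map_neg x

@[simp]
lemma ofSec_zero {F : PSh a} {X : a} : ofSec (0 : F.sec X) = 0 :=
  hom_ext fun _ f => (F.res f).map_zero

lemma app_injective_of_mono {F G : PSh a} (i : F ⟶ G) [Mono i] (X : a) :
    Function.Injective (app i X) := fun x y h => by
  apply ofSec_injective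
  rw [← cancel_mono i, ofSec_comp, ofSec_comp, h]

/-- A morphism lifts through a sectionwise injective morphism as soon as its sections do. -/
lemma exists_lift {A B H : PSh a} (i : A ⟶ B) (hi : ∀ X, Function.Injective (app i X))
    (h : H ⟶ B) (hh : ∀ (X : a) (x : H.sec X), ∃ y, app i X y = app h X x) :
    ∃ l : H ⟶ A, l ≫ i = h := by
  choose l hl using hh
  refine ⟨homMk (fun X => { toFun := l X, map_zero' := ?_, map_add' := ?_ }) ?_, ?_⟩
  · exact hi X (by simp [hl])
  · exact fun x y => hi X (by simp [hl])
  · exact fun f x => hi _ (by simp [hl, app_res])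
  · exact hom_ext fun X x => hl X x

end PSh

end Presheaves

/-! ### Subpresheaves, their sieves and their quotients -/

section Subpresheaves

variable {a : Type u} [Category.{v} a] [Preadditive a]

/-- An additive subpresheaf of an additive presheaf. -/
structure SubPSh (F : PSh a) where
  /-- The subgroup of sections over `X`. -/
  sub (X : a) : AddSubgroup (F.sec X)
  res_mem {X Y : a} (f : Y ⟶ X) {x : F.sec X} (hx : x ∈ sub X) : F.res f x ∈ sub Y

lemma AdditiveSieve.ext {X : a} {R S : AdditiveSieve X}
    (h : ∀ (Y : a) (f : Y ⟶ X), f ∈ R.homs Y ↔ f ∈ S.homs Y) : R = S := by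
  obtain ⟨R, _⟩ := R
  obtain ⟨S, _⟩ := S
  obtain rfl : R = S := funext fun Y => AddSubgroup.ext (h Y)
  rfl

lemma AdditiveSieve.mem_pullback {X Y Z : a} (R : AdditiveSieve X) (f : Y ⟶ X) (g : Z ⟶ Y) :
    g ∈ (R.pullback f).homs Z ↔ g ≫ f ∈ R.homs Z := Iff.rfl

namespace SubPSh

variable {F : PSh a}

/-- The zero subpresheaf. -/
def bot (F : PSh a) : SubPSh F where
  sub _ := ⊥
  res_mem {_ _} f {x} hx := by
    rw [AddSubgroup.mem_bot] at hx ⊢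
    rw [hx, map_zero]

/-- The sectionwise range of a morphism. -/
def range {G : PSh a} (α : G ⟶ F) : SubPSh F where
  sub X := (PSh.app α X).range
  res_mem := by
    rintro X Y f _ ⟨x, rfl⟩
    exact ⟨G.res f x, PSh.app_res α f x⟩

/-- The sieve of the morphisms along which `x` restricts into a subpresheaf. -/
def sieve (S : SubPSh F) {X : a} (x : F.sec X) : AdditiveSieve X where
  homs Y :=
    { carrier := {f | F.res f x ∈ S.sub Y}
      zero_mem' := by simp [F.res_zero_hom]
      add_mem' := fun {f g} hf hg => by
        simpa [F.res_add_hom] using add_mem hf hg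
      neg_mem' := fun {f} hf => by
        simpa [F.res_neg_hom] using hf }
  comp_mem {Y Z f} hf g := by
    change F.res (g ≫ f) x ∈ S.sub Z
    rw [← F.res_res]
    exact S.res_mem g hf

lemma mem_sieve (S : SubPSh F) {X Y : a} (x : F.sec X) (f : Y ⟶ X) :
    f ∈ (S.sieve x).homs Y ↔ F.res f x ∈ S.sub Y := Iff.rfl

lemma mem_sieve_bot {X Y : a} (x : F.sec X) (f : Y ⟶ X) :
    f ∈ ((bot F).sieve x).homs Y ↔ F.res f x = 0 := Iff.rfl

lemma sieve_pullback (S : SubPSh F) {X Y : a} (x : F.sec X) (f : Y ⟶ X) :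
    (S.sieve x).pullback f = S.sieve (F.res f x) :=
  AdditiveSieve.ext fun Z g => by
    rw [AdditiveSieve.mem_pullback, mem_sieve, mem_sieve, F.res_res]

/-- A subpresheaf, as a presheaf. -/
def toPSh (S : SubPSh F) : PSh a :=
  PSh.ofSections (fun X => S.sub X)
    (fun {X Y} f => ((F.res f).comp (S.sub X).subtype).codRestrict (S.sub Y)
      fun x => S.res_mem f x.2)
    (fun _ x => Subtype.ext (F.res_id x.1))
    (fun f g x => Subtype.ext (F.res_res f g x.1).symm)
    (fun f g x => Subtype.ext (F.res_add_hom f g x.1))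

/-- The inclusion of a subpresheaf. -/
def incl (S : SubPSh F) : S.toPSh ⟶ F :=
  PSh.homMk (F := S.toPSh) (fun X => (S.sub X).subtype) (fun _ _ => rfl)

lemma incl_injective (S : SubPSh F) (X : a) : Function.Injective (PSh.app S.incl X) :=
  Subtype.val_injective

lemma incl_mem (S : SubPSh F) {X : a} (x : S.toPSh.sec X) : PSh.app S.incl X x ∈ S.sub X :=
  x.2

lemma exists_incl_eq (S : SubPSh F) {X : a} {x : F.sec X} (hx : x ∈ S.sub X) :
    ∃ y, PSh.app S.incl X y = x := ⟨⟨x, hx⟩, rfl⟩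

/-- The quotient by a subpresheaf. -/
def quot (S : SubPSh F) : PSh a :=
  PSh.ofSections (fun X => F.sec X ⧸ S.sub X)
    (fun {X Y} f => QuotientAddGroup.map (S.sub X) (S.sub Y) (F.res f) fun _ hx => S.res_mem f hx)
    (fun X x => by
      obtain ⟨x, rfl⟩ := QuotientAddGroup.mk_surjective x
      exact congrArg _ (F.res_id x))
    (fun f g x => by
      obtain ⟨x, rfl⟩ := QuotientAddGroup.mk_surjective x
      exact congrArg _ (F.res_res f g x).symm)
    (fun f g x => by
      obtain ⟨x, rfl⟩ := QuotientAddGroup.mk_surjective x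
      exact congrArg _ (F.res_add_hom f g x))

/-- The projection to the quotient by a subpresheaf. -/
def proj (S : SubPSh F) : F ⟶ S.quot :=
  PSh.homMk (G := S.quot) (fun X => QuotientAddGroup.mk' (S.sub X)) (fun _ _ => rfl)

lemma proj_surjective (S : SubPSh F) (X : a) : Function.Surjective (PSh.app S.proj X) :=
  QuotientAddGroup.mk_surjective

lemma proj_eq_zero_iff (S : SubPSh F) {X : a} (x : F.sec X) :
    PSh.app S.proj X x = 0 ↔ x ∈ S.sub X :=
  QuotientAddGroup.eq_zero_iff x

end SubPSh

end Subpresheaves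

/-! ### Local conditions, gluing and bicovering morphisms -/

section Topology

variable {a : Type u} [Category.{v} a] [Preadditive a] (T : AdditiveTopology a)

namespace AdditiveTopology

/-- The pullback of `S` along a member of `R` is maximal, so transitivity applies. -/
lemma mem_of_le {X : a} {R S : AdditiveSieve X} (hR : R ∈ T.covers X)
    (h : ∀ (Y : a) (f : Y ⟶ X), f ∈ R.homs Y → f ∈ S.homs Y) : S ∈ T.covers X := by
  refine T.transitive hR S fun Y f hf => ?_
  convert T.top_mem Y
  exact AdditiveSieve.ext fun Z g => ⟨fun _ => AddSubgroup.mem_top _,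
    fun _ => h _ _ (R.comp_mem hf g)⟩

variable {F : PSh a}

lemma sieve_mem_of_mem (S : SubPSh F) {X : a} {x : F.sec X} (hx : x ∈ S.sub X) :
    S.sieve x ∈ T.covers X :=
  T.mem_of_le (T.top_mem X) fun _ f _ => S.res_mem f hx

lemma sieve_res_mem {S : SubPSh F} {X Y : a} {x : F.sec X} (hx : S.sieve x ∈ T.covers X)
    (f : Y ⟶ X) : S.sieve (F.res f x) ∈ T.covers Y := by
  rw [← SubPSh.sieve_pullback]
  exact T.pullback_mem hx f

/-- Covering a section by a subpresheaf is a local condition. -/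
lemma sieve_mem_of_local {S : SubPSh F} {X : a} {x : F.sec X} {R : AdditiveSieve X}
    (hR : R ∈ T.covers X)
    (h : ∀ (Y : a) (f : Y ⟶ X), f ∈ R.homs Y → S.sieve (F.res f x) ∈ T.covers Y) :
    S.sieve x ∈ T.covers X := by
  refine T.transitive hR _ fun Y f hf => ?_
  rw [SubPSh.sieve_pullback]
  exact h Y f hf

/-- The sections which lie locally in a subpresheaf. -/
def closure (S : SubPSh F) : SubPSh F where
  sub X :=
    { carrier := {x | S.sieve x ∈ T.covers X}
      zero_mem' := T.sieve_mem_of_mem S (zero_mem _)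
      -- Along the covering sieve on which `x` restricts into `S`, only `y` still matters.
      add_mem' := fun {x y} hx hy => T.sieve_mem_of_local hx fun Y f hf =>
        T.mem_of_le (T.sieve_res_mem hy f) fun Z g hg => by
          rw [SubPSh.mem_sieve] at hg ⊢
          rw [map_add, map_add]
          exact add_mem (S.res_mem g hf) hg
      neg_mem' := fun {x} hx => T.mem_of_le hx fun Z g hg => by
        rw [SubPSh.mem_sieve] at hg ⊢
        rw [map_neg]
        exact neg_mem hg }
  res_mem f _ hx := T.sieve_res_mem hx f

lemma mem_closure {S : SubPSh F} {X : a} {x : F.sec X} :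
    x ∈ (T.closure S).sub X ↔ S.sieve x ∈ T.covers X := Iff.rfl

/-- The torsion subpresheaf: the sections which vanish locally. -/
abbrev torsion (F : PSh a) : SubPSh F := T.closure (SubPSh.bot F)

end AdditiveTopology

variable {T}

namespace IsSheaf

variable {F : PSh a}

lemma eq_zero (hF : IsSheaf T F) {X : a} {R : AdditiveSieve X} (hR : R ∈ T.covers X)
    {x : F.sec X} (hx : ∀ (Y : a) (f : Y ⟶ X), f ∈ R.homs Y → F.res f x = 0) : x = 0 := by
  apply PSh.ofSec_injective
  apply (hF X R hR).1
  refine PSh.hom_ext fun Y f => ?_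
  change F.res f.1 x = F.res f.1 0
  rw [hx Y f.1 f.2, map_zero]

lemma eq_of_locally_eq (hF : IsSheaf T F) {X : a} {R : AdditiveSieve X} (hR : R ∈ T.covers X)
    {x y : F.sec X} (h : ∀ (Y : a) (f : Y ⟶ X), f ∈ R.homs Y → F.res f x = F.res f y) : x = y :=
  sub_eq_zero.1 (hF.eq_zero hR fun Y f hf => by rw [map_sub, h Y f hf, sub_self])

/-- Gluing along an additive and natural functional relation on a covering sieve. -/
lemma exists_glue (hF : IsSheaf T F) {X : a} {R : AdditiveSieve X} (hR : R ∈ T.covers X)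
    (r : ∀ Y : a, (Y ⟶ X) → F.sec Y → Prop)
    (total : ∀ (Y : a) (f : Y ⟶ X), f ∈ R.homs Y → ∃ s, r Y f s)
    (zero : ∀ (Y : a) (s : F.sec Y), r Y 0 s → s = 0)
    (sub : ∀ (Y : a) (f g : Y ⟶ X) (s t : F.sec Y), r Y f s → r Y g t → r Y (f - g) (s - t))
    (res : ∀ (Y Z : a) (f : Y ⟶ X) (g : Z ⟶ Y) (s : F.sec Y), r Y f s →
      r Z (g ≫ f) (F.res g s)) :
    ∃ x : F.sec X, ∀ (Y : a) (f : Y ⟶ X) (s : F.sec Y), f ∈ R.homs Y → r Y f s →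
      F.res f x = s := by
  -- The conditions `zero` and `sub` make the relation single-valued.
  have uniq : ∀ (Y : a) (f : Y ⟶ X) (s t : F.sec Y), r Y f s → r Y f t → s = t :=
    fun Y f s t hs ht => sub_eq_zero.1 (zero Y _ (by simpa using sub Y f f s t hs ht))
  choose s hs using total
  have s_sub : ∀ (Y : a) (f g : Y ⟶ X) (hf hg),
      s Y (f - g) (sub_mem hf hg) = s Y f hf - s Y g hg :=
    fun Y f g hf hg => uniq Y _ _ _ (hs _ _ _) (sub Y f g _ _ (hs _ _ _) (hs _ _ _))
  let φ : R.toPSh ⟶ F := PSh.homMk (F := R.toPSh)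
    (fun Y => AddMonoidHom.ofMapSub (fun f : R.homs Y => s Y f.1 f.2)
      fun f g => s_sub Y f.1 g.1 f.2 g.2)
    (fun {Y Z} g f => uniq Z _ _ _ (hs _ _ _) (res Y Z f.1 g _ (hs _ _ _)))
  obtain ⟨ψ, hψ⟩ := (hF X R hR).2 φ
  refine ⟨PSh.toSec ψ, fun Y f t hf ht => ?_⟩
  rw [← PSh.app_eq_res_toSec]
  exact (congrArg (fun α : R.toPSh ⟶ F => PSh.app α Y ⟨f, hf⟩) hψ).trans
    (uniq Y f _ _ (hs _ _ _) ht)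

/-- A section which lies locally in a sheaf lies in it. -/
lemma mem_range_of_locally {A B : PSh a} (hA : IsSheaf T A) (hB : IsSheaf T B) (i : A ⟶ B)
    (hi : ∀ X, Function.Injective (PSh.app i X)) {X : a} (x : B.sec X)
    (hx : (SubPSh.range i).sieve x ∈ T.covers X) : ∃ y, PSh.app i X y = x := by
  obtain ⟨y, hy⟩ := hA.exists_glue hx (fun Y f s => PSh.app i Y s = B.res f x)
    (fun Y f hf => hf) (fun Y s hs => hi Y (by rw [hs, B.res_zero_hom, map_zero]))
    (fun Y f g s t hs ht => by
      rw [map_sub, hs, ht, sub_eq_add_neg f, B.res_add_hom, B.res_neg_hom, sub_eq_add_neg])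
    (fun Y Z f g s hs => by rw [PSh.app_res, hs, B.res_res])
  refine ⟨y, hB.eq_of_locally_eq hx fun Y f hf => ?_⟩
  obtain ⟨s, hs⟩ := hf
  rw [← PSh.app_res, hy Y f s ⟨s, hs⟩ hs, hs]

lemma of_exists_unique
    (sep : ∀ (X : a) (x : F.sec X), (SubPSh.bot F).sieve x ∈ T.covers X → x = 0)
    (glue : ∀ (X : a) (R : AdditiveSieve X), R ∈ T.covers X → ∀ φ : R.toPSh ⟶ F,
      ∃ x : F.sec X, ∀ (Y : a) (f : R.toPSh.sec Y), F.res f.1 x = PSh.app φ Y f) :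
    IsSheaf T F := by
  refine fun X R hR => ⟨fun φ ψ h => ?_, fun φ => ?_⟩
  · rw [← PSh.ofSec_toSec φ, ← PSh.ofSec_toSec ψ]
    refine congrArg _ (sub_eq_zero.1 (sep X _ (T.mem_of_le hR fun Y f hf => ?_)))
    rw [SubPSh.mem_sieve_bot, map_sub, sub_eq_zero, ← PSh.app_eq_res_toSec, ← PSh.app_eq_res_toSec]
    exact congrArg (fun α : R.toPSh ⟶ F => PSh.app α Y ⟨f, hf⟩) h
  · obtain ⟨x, hx⟩ := glue X R hR φ
    exact ⟨PSh.ofSec x, PSh.hom_ext fun Y f => hx Y f⟩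

end IsSheaf

variable (T)

/-- A morphism of presheaves which is locally injective and locally surjective. -/
structure IsBicovering {F N : PSh a} (c : F ⟶ N) : Prop where
  ker (X : a) (x : F.sec X) : PSh.app c X x = 0 → (SubPSh.bot F).sieve x ∈ T.covers X
  coker (X : a) (n : N.sec X) : (SubPSh.range c).sieve n ∈ T.covers X

variable {T}

namespace IsBicovering

variable {F N G : PSh a} {c : F ⟶ N}

lemma hom_ext (hc : IsBicovering T c) (hG : IsSheaf T G) {α β : N ⟶ G} (h : c ≫ α = c ≫ β) :
    α = β := by
  refine PSh.hom_ext fun X n => hG.eq_of_locally_eq (hc.coker X n) fun Y f hf => ?_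
  obtain ⟨y, hy⟩ := hf
  rw [← PSh.app_res, ← PSh.app_res, ← hy]
  exact congrArg (fun α => PSh.app α Y y) h

/-- A section of `N` has local preimages in `F`, unique up to locally vanishing sections. As `G` is
separated, `ψ` takes well-defined values on them, and these glue. -/
lemma exists_desc (hc : IsBicovering T c) (hG : IsSheaf T G) (ψ : F ⟶ G) :
    ∃ α : N ⟶ G, c ≫ α = ψ := by
  have key : ∀ (X : a) (n : N.sec X), ∃ z : G.sec X, ∀ (Y : a) (f : Y ⟶ X) (y : F.sec Y),
      PSh.app c Y y = N.res f n → G.res f z = PSh.app ψ Y y := by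
    intro X n
    obtain ⟨z, hz⟩ := hG.exists_glue (hc.coker X n)
      (fun Y f s => ∃ y, PSh.app c Y y = N.res f n ∧ PSh.app ψ Y y = s)
      (fun Y f ⟨y, hy⟩ => ⟨_, y, hy, rfl⟩)
      (by
        rintro Y _ ⟨y, hy, rfl⟩
        rw [N.res_zero_hom] at hy
        refine hG.eq_zero (hc.ker Y y hy) fun Z g hg => ?_
        rw [← PSh.app_res, (SubPSh.mem_sieve_bot y g).1 hg, map_zero])
      (by
        rintro Y f g _ _ ⟨y, hy, rfl⟩ ⟨z, hz, rfl⟩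
        exact ⟨y - z, by rw [map_sub, hy, hz, sub_eq_add_neg f, N.res_add_hom, N.res_neg_hom,
          sub_eq_add_neg], map_sub _ _ _⟩)
      (by
        rintro Y Z f g _ ⟨y, hy, rfl⟩
        exact ⟨F.res g y, by rw [PSh.app_res, hy, N.res_res], PSh.app_res ψ g y⟩)
    exact ⟨z, fun Y f y hy => hz Y f _ ⟨y, hy⟩ ⟨y, hy, rfl⟩⟩
  have uniq : ∀ (X : a) (n : N.sec X) (z z' : G.sec X),
      (∀ (Y : a) (f : Y ⟶ X) (y : F.sec Y), PSh.app c Y y = N.res f n →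
        G.res f z = PSh.app ψ Y y) →
      (∀ (Y : a) (f : Y ⟶ X) (y : F.sec Y), PSh.app c Y y = N.res f n →
        G.res f z' = PSh.app ψ Y y) → z = z' := fun X n z z' hz hz' =>
    hG.eq_of_locally_eq (hc.coker X n) fun Y f ⟨y, hy⟩ => (hz Y f y hy).trans (hz' Y f y hy).symm
  choose z hz using key
  refine ⟨PSh.homMk (fun X => AddMonoidHom.ofMapSub (z X) fun n m => ?_) fun {X Y} f n => ?_, ?_⟩
  -- Additivity is checked where both `n` and `m` have preimages, hence along two successive
  -- coverings.
  · refine hG.eq_of_locally_eq (hc.coker X n) fun Y f ⟨y, hy⟩ => ?_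
    refine hG.eq_of_locally_eq (hc.coker Y (N.res f m)) fun Z g ⟨w, hw⟩ => ?_
    have hy' : PSh.app c Z (F.res g y) = N.res (g ≫ f) n := by
      rw [PSh.app_res, hy, N.res_res]
    rw [N.res_res] at hw
    rw [G.res_res, G.res_res, map_sub, hz X n _ _ _ hy', hz X m _ _ _ hw, ← map_sub]
    exact hz X _ _ _ _ (by rw [map_sub, map_sub, hy', hw])
  · refine uniq Y _ _ _ (hz Y _) fun Z g y hy => ?_
    rw [G.res_res]
    exact hz X n _ _ y (by rw [hy, N.res_res])
  · exact PSh.hom_ext fun X y => by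
      have := hz X (PSh.app c X y) X (𝟙 X) y (by rw [N.res_id])
      rwa [G.res_id] at this

end IsBicovering

end Topology

/-! ### Existence of sheafification -/

section SmallObjects

variable {a : Type u} [Category.{v} a] [EssentiallySmall.{v} a]

variable (a) in
/-- A small family of objects which contains every object up to isomorphism. -/
def smallObj (i : SmallModel.{v} a) : a := (equivSmallModel.{v} a).inverse.obj i

lemma exists_iso_smallObj (X : a) : ∃ i, Nonempty (X ≅ smallObj a i) :=
  ⟨_, ⟨(equivSmallModel.{v} a).unitIso.app X⟩⟩

end SmallObjects

section Sheafification

variable {a : Type u} [Category.{v} a] [Preadditive a]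

namespace AdditiveTopology

variable (T : AdditiveTopology a)

/-- By transitivity, a section that is locally torsion is torsion. -/
lemma torsion_quot_separated (F : PSh a) {X : a} (n : (T.torsion F).quot.sec X)
    (hn : (SubPSh.bot _).sieve n ∈ T.covers X) : n = 0 := by
  obtain ⟨m, rfl⟩ := (T.torsion F).proj_surjective X n
  rw [SubPSh.proj_eq_zero_iff]
  exact T.sieve_mem_of_local hn fun Y f hf => by
    rw [SubPSh.mem_sieve_bot, ← PSh.app_res, SubPSh.proj_eq_zero_iff] at hf
    exact hf

end AdditiveTopology

variable [EssentiallySmall.{v} a]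

namespace PSh

/-- A presheaf which contains `F` and to which morphisms from sieves extend. -/
def hull (F : PSh a) : PSh a :=
  -- `AddCircle (1 : ℚ)` is `ℚ/ℤ`. For `A` fixed, morphisms from `P` to `X ↦ Hom(a(A, X), ℚ/ℤ)` are
  -- the characters of `P(A)`, so this presheaf is injective. One factor for each character of each
  -- `F(A)` is enough to separate the sections of `F`.
  ofSections (fun X => ∀ i : SmallModel.{v} a, (F.sec (smallObj a i) →+ AddCircle (1 : ℚ)) →
      ((smallObj a i ⟶ X) →+ AddCircle (1 : ℚ)))
    (fun f => { toFun := fun e i ξ => (e i ξ).comp (Preadditive.rightComp (smallObj a i) f)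
                map_zero' := rfl
                map_add' := fun _ _ => rfl })
    (fun X e => by
      funext i ξ
      ext g
      exact congrArg (e i ξ) (Category.comp_id g))
    (fun f g e => by
      funext i ξ
      ext h
      exact congrArg (e i ξ) (Category.assoc h g f).symm)
    (fun f g e => by
      funext i ξ
      ext h
      exact (congrArg (e i ξ) (Preadditive.comp_add _ _ _ h f g)).trans (map_add _ _ _))

/-- The canonical morphism of a presheaf into its hull. -/
def toHull (F : PSh a) : F ⟶ F.hull :=
  homMk (G := F.hull)
    (fun X => { toFun := fun x i ξ =>
                  { toFun := fun g => ξ (F.res g x)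
                    map_zero' := by rw [F.res_zero_hom, map_zero]
                    map_add' := fun g h => by rw [F.res_add_hom, map_add] }
                map_zero' := by
                  funext i ξ
                  ext g
                  exact (congrArg ξ (map_zero (F.res g))).trans (map_zero ξ)
                map_add' := fun x y => by
                  funext i ξ
                  ext g
                  exact (congrArg ξ (map_add (F.res g) x y)).trans (map_add ξ _ _) })
    (fun f x => by
      funext i ξ
      ext g
      exact congrArg ξ (F.res_res f g x))

lemma toHull_injective (F : PSh a) (X : a) : Function.Injective (app F.toHull X) := by
  rw [injective_iff_map_eq_zero]
  intro x hx
  obtain ⟨i, ⟨e⟩⟩ := exists_iso_smallObj X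
  have h : F.res e.inv x = 0 := CharacterModule.eq_zero_of_character_apply fun ξ =>
    DFunLike.congr_fun (congrFun (congrFun hx i) ξ) e.inv
  rw [← F.res_id x, ← e.hom_inv_id, ← F.res_res, h, map_zero]

/-- Each component of `φ` is a character of a group `R(A)`, read off at the identity of `A`. It
extends to `a(A, X)` since `ℚ/ℤ` is injective, and a family of such extensions is a section of the
hull. -/
lemma hull_extends (F : PSh a) {X : a} (R : AdditiveSieve X) (φ : R.toPSh ⟶ F.hull) :
    ∃ e : F.hull.sec X, ∀ (Y : a) (f : R.toPSh.sec Y), F.hull.res f.1 e = app φ Y f := by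
  let χ (i : SmallModel.{v} a) (ξ : F.sec (smallObj a i) →+ AddCircle (1 : ℚ)) :
      R.homs (smallObj a i) →+ AddCircle (1 : ℚ) :=
    { toFun := fun g => (app φ (smallObj a i) g : F.hull.sec (smallObj a i)) i ξ (𝟙 _)
      map_zero' := by
        exact congrArg (fun e : F.hull.sec (smallObj a i) => e i ξ (𝟙 _))
          (map_zero (app φ (smallObj a i)))
      map_add' := fun g h => by
        exact congrArg (fun e : F.hull.sec (smallObj a i) => e i ξ (𝟙 _))
          (map_add (app φ (smallObj a i)) g h) }
  have hχ : ∀ i ξ, ∃ χ' : (smallObj a i ⟶ X) →+ AddCircle (1 : ℚ),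
      ∀ g : R.homs (smallObj a i), χ' g.1 = χ i ξ g := by
    intro i ξ
    obtain ⟨χ', h⟩ := CharacterModule.dual_surjective_of_injective
      (R.homs (smallObj a i)).subtype.toIntLinearMap Subtype.val_injective (χ i ξ)
    exact ⟨χ', fun g => DFunLike.congr_fun h g⟩
  choose χ' hχ' using hχ
  refine ⟨χ', fun Y f => ?_⟩
  funext i ξ
  ext g
  refine (hχ' i ξ ⟨g ≫ f.1, R.comp_mem f.2 g⟩).trans ?_
  refine (congrArg (fun e : F.hull.sec (smallObj a i) => e i ξ (𝟙 _)) (app_res φ g f)).trans ?_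
  exact congrArg ((app φ Y f : F.hull.sec Y) i ξ) (Category.id_comp g)

end PSh

variable (T : AdditiveTopology a)

/-- Killing torsion gives `F₁`, whose closure `M` in its hull contains all possible gluings. The
hull may have torsion, so the sheaf is `M` modulo torsion; `F₁`, being torsion-free, still embeds in
it. -/
lemma exists_isBicovering_isSheaf (F : PSh a) :
    ∃ (N : PSh a) (c : F ⟶ N), IsSheaf T N ∧ IsBicovering T c := by
  let p := (T.torsion F).proj
  let F₁ := (T.torsion F).quot
  let M := T.closure (SubPSh.range F₁.toHull)
  obtain ⟨j, hj⟩ := PSh.exists_lift M.incl M.incl_injective F₁.toHull fun X x =>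
    M.exists_incl_eq (T.sieve_mem_of_mem _ ⟨x, rfl⟩)
  have j_inj : ∀ X, Function.Injective (PSh.app j X) := fun X x y h =>
    F₁.toHull_injective X (by rw [← hj, PSh.app_comp, PSh.app_comp, h])
  let q := (T.torsion M.toPSh).proj
  have p_ker : ∀ (X : a) (x : F.sec X),
      (SubPSh.bot F₁).sieve (PSh.app p X x) ∈ T.covers X → (SubPSh.bot F).sieve x ∈ T.covers X :=
    fun X x hx => T.sieve_mem_of_local hx fun Y f hf => by
      rw [SubPSh.mem_sieve_bot, ← PSh.app_res] at hf
      exact ((T.torsion F).proj_eq_zero_iff _).1 hf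
  have M_coker : ∀ (X : a) (m : M.toPSh.sec X),
      (SubPSh.range j).sieve m ∈ T.covers X := fun X m =>
    T.mem_of_le (M.incl_mem m) fun Y f ⟨y, hy⟩ => ⟨y, M.incl_injective Y (by
      rw [← PSh.app_comp, hj, hy, PSh.app_res])⟩
  have jq_ker : ∀ (X : a) (x : F₁.sec X), PSh.app q X (PSh.app j X x) = 0 →
      (SubPSh.bot F₁).sieve x ∈ T.covers X := fun X x hx => by
    rw [SubPSh.proj_eq_zero_iff, T.mem_closure] at hx
    refine T.mem_of_le hx fun Y f hf => ?_
    rw [SubPSh.mem_sieve_bot, ← PSh.app_res] at hf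
    exact j_inj Y (hf.trans (map_zero _).symm)
  have jq_inj : ∀ X, Function.Injective (PSh.app (j ≫ q) X) := fun X => by
    rw [injective_iff_map_eq_zero]
    exact fun x hx => T.torsion_quot_separated F x (jq_ker X x hx)
  have jq_coker : ∀ (X : a) n, (SubPSh.range (j ≫ q)).sieve n ∈ T.covers X := fun X n => by
    obtain ⟨m, rfl⟩ := (T.torsion M.toPSh).proj_surjective X n
    refine T.mem_of_le (M_coker X m) fun Y f ⟨y, hy⟩ => ⟨y, ?_⟩
    rw [PSh.app_comp, ← PSh.app_res, ← hy]
  refine ⟨_, p ≫ j ≫ q, IsSheaf.of_exists_unique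
    (fun X n => T.torsion_quot_separated M.toPSh n) fun X R hR φ => ?_, ⟨?_, ?_⟩⟩
  -- The members of `R` at which `φ` takes a value in the image of `F₁`; they still form a covering
  -- sieve.
  · let S : AdditiveSieve X :=
      { homs := fun Y =>
          (((SubPSh.range (j ≫ q)).sub Y).comap (PSh.app φ Y)).map (R.homs Y).subtype
        comp_mem := by
          rintro Y Z _ ⟨f, hf, rfl⟩ g
          refine ⟨R.toPSh.res g f, ?_, rfl⟩
          exact (congrArg (fun n => n ∈ (SubPSh.range (j ≫ q)).sub Z) (PSh.app_res φ g f)).mpr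
            (SubPSh.res_mem _ g hf) }
    have hS : ∀ (Y : a) (f : R.toPSh.sec Y), S.pullback f.1 ∈ T.covers Y := fun Y f =>
      T.mem_of_le (jq_coker Y (PSh.app φ Y f)) fun Z g hg => by
        refine ⟨R.toPSh.res g f, ?_, rfl⟩
        exact (congrArg (fun n => n ∈ (SubPSh.range (j ≫ q)).sub Z) (PSh.app_res φ g f)).mpr hg
    have S_le : ∀ (Y : a) (f : Y ⟶ X), f ∈ S.homs Y → f ∈ R.homs Y := by
      rintro Y _ ⟨f, -, rfl⟩
      exact f.2
    let k : S.toPSh ⟶ R.toPSh := PSh.homMk (F := S.toPSh) (G := R.toPSh)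
      (fun Y => AddSubgroup.inclusion (S_le Y)) (fun _ _ => rfl)
    obtain ⟨ψ, hψ⟩ := PSh.exists_lift (j ≫ q) jq_inj (k ≫ φ) fun Y f => by
      obtain ⟨f, g, hg, rfl⟩ := f
      exact hg
    -- The extension `e` lies in `F₁` along `S`, hence in the closure `M`.
    obtain ⟨e, he⟩ := F₁.hull_extends S (ψ ≫ F₁.toHull)
    obtain ⟨m, hm⟩ := M.exists_incl_eq (x := e)
      (T.mem_of_le (T.transitive hR S fun Y f hf => hS Y ⟨f, hf⟩) fun Y f hf =>
        ⟨PSh.app ψ Y ⟨f, hf⟩, (he Y ⟨f, hf⟩).symm⟩)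
    have hm' : ∀ (Y : a) (f : S.toPSh.sec Y),
        M.toPSh.res f.1 m = PSh.app j Y (PSh.app ψ Y f) := fun Y f => by
      apply M.incl_injective Y
      rw [PSh.app_res, hm, he, ← PSh.app_comp, hj, PSh.app_comp]
    -- The image of `m` agrees with `φ` on `S`, hence on all of `R` because the quotient is
    -- separated.
    refine ⟨PSh.app q X m, fun Y f => sub_eq_zero.1 <|
      T.torsion_quot_separated M.toPSh _ (T.mem_of_le (hS Y f) fun Z g hg => ?_)⟩
    rw [SubPSh.mem_sieve_bot, map_sub, sub_eq_zero, PSh.res_res, ← PSh.app_res,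
      hm' Z ⟨g ≫ f.1, hg⟩, ← PSh.app_res]
    exact congrArg (fun α : S.toPSh ⟶ _ => PSh.app α Z ⟨g ≫ f.1, hg⟩) hψ
  · exact fun X x hx => p_ker X x (jq_ker X _ hx)
  · intro X n
    refine T.mem_of_le (jq_coker X n) fun Y f ⟨y, hy⟩ => ?_
    obtain ⟨x, rfl⟩ := (T.torsion F).proj_surjective Y y
    exact ⟨x, hy⟩

instance isRightAdjoint_shInclusion : (shInclusion T).IsRightAdjoint := by
  rw [isRightAdjoint_iff_hasInitial_structuredArrow]
  intro F
  obtain ⟨N, c, hN, hc⟩ := exists_isBicovering_isSheaf T F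
  refine IsInitial.hasInitial (X := StructuredArrow.mk (Y := (⟨N, hN⟩ : Sh T)) (f := c)) ?_
  refine IsInitial.ofUniqueHom (fun G => StructuredArrow.homMk
    (ObjectProperty.homMk (hc.exists_desc G.right.property G.hom).choose)
    (hc.exists_desc G.right.property G.hom).choose_spec) fun G m => ?_
  refine StructuredArrow.ext _ _ (ObjectProperty.hom_ext _ (hc.hom_ext G.right.property ?_))
  exact (StructuredArrow.w m).trans (hc.exists_desc G.right.property G.hom).choose_spec.symm

/-- The adjunction between sheafification and the inclusion of sheaves. -/
def sheafificationAdjunction : sheafification T ⊣ shInclusion T :=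
  Adjunction.ofIsRightAdjoint (shInclusion T)

/-- The canonical morphism from a presheaf to its sheafification. -/
def toSheafification (F : PSh a) : F ⟶ ((sheafification T).obj F).obj :=
  (sheafificationAdjunction T).unit.app F

lemma toSheafification_naturality {F G : PSh a} (f : F ⟶ G) :
    f ≫ toSheafification T G = toSheafification T F ≫ ((sheafification T).map f).hom :=
  (sheafificationAdjunction T).unit.naturality f

lemma sheafification_hom_ext {F : PSh a} {G : Sh T} {α β : (sheafification T).obj F ⟶ G}
    (h : toSheafification T F ≫ α.hom = toSheafification T F ≫ β.hom) : α = β := by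
  apply ((sheafificationAdjunction T).homEquiv F G).injective
  rw [Adjunction.homEquiv_unit, Adjunction.homEquiv_unit]
  exact h

lemma exists_sheafification_desc {F : PSh a} (G : Sh T) (ψ : F ⟶ G.obj) :
    ∃ α : (sheafification T).obj F ⟶ G, toSheafification T F ≫ α.hom = ψ := by
  refine ⟨((sheafificationAdjunction T).homEquiv F G).symm ψ, ?_⟩
  refine Eq.trans ?_ (((sheafificationAdjunction T).homEquiv F G).apply_symm_apply ψ)
  rw [Adjunction.homEquiv_unit]
  rfl

lemma isBicovering_toSheafification (F : PSh a) : IsBicovering T (toSheafification T F) := by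
  obtain ⟨N, c, hN, hc⟩ := exists_isBicovering_isSheaf T F
  obtain ⟨c', hc'⟩ := exists_sheafification_desc T ⟨N, hN⟩ c
  obtain ⟨d, hd⟩ := hc.exists_desc ((sheafification T).obj F).property (toSheafification T F)
  -- The comparison `c'` with the bicovering `c` has a retraction, which is enough to carry both
  -- properties over to the unit.
  have h : c'.hom ≫ d = 𝟙 _ := by
    have : c' ≫ ObjectProperty.homMk d = 𝟙 ((sheafification T).obj F) := by
      apply sheafification_hom_ext
      change toSheafification T F ≫ c'.hom ≫ d = toSheafification T F ≫ 𝟙 _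
      rw [← Category.assoc, hc', hd, Category.comp_id]
    exact congrArg (fun f => f.hom) this
  refine ⟨fun X x hx => hc.ker X x ?_, fun X s => ?_⟩
  · rw [← hc', PSh.app_comp, hx, map_zero]
  · refine T.mem_of_le (hc.coker X (PSh.app c'.hom X s)) fun Y f ⟨y, hy⟩ => ⟨y, ?_⟩
    rw [← hd, PSh.app_comp, hy, ← PSh.app_res, ← PSh.app_comp, h, PSh.app_id]

instance : (sheafification T).Additive := (sheafificationAdjunction T).left_adjoint_additive

instance : PreservesColimitsOfSize.{v, v} (sheafification T) :=
  (sheafificationAdjunction T).leftAdjoint_preservesColimits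

end Sheafification

/-! ### Covers induced by a functor -/

section InducedCovers

variable {C : Type w₁} [Category.{w₁'} C] [Preadditive C]

lemma epi_sigmaDesc_iff {ι : Type*} {Y : ι → C} [HasCoproduct Y] {X : C} (f : ∀ i, Y i ⟶ X) :
    Epi (Sigma.desc f) ↔ ∀ (Q : C) (u : X ⟶ Q), (∀ i, f i ≫ u = 0) → u = 0 := by
  refine ⟨fun _ Q u hu => ?_, fun h => Preadditive.epi_of_cancel_zero _ fun {Q} u hu => h Q u ?_⟩
  · rw [← cancel_epi (Sigma.desc f), comp_zero]
    exact Sigma.hom_ext _ _ fun i => by simp [hu]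
  · intro i
    rw [← Sigma.ι_desc f i, Category.assoc, hu, comp_zero]

variable {a : Type u} [Category.{v} a] [Preadditive a] [EssentiallySmall.{v} a]
  [HasColimitsOfSize.{v, v} C]

/-- The members of `R` whose source is in a small skeleton form a small family, and every other
member factors through one of them by an isomorphism of sources. -/
lemma mem_inducedCovers_iff (θ : a ⥤ C) {X : a} (R : AdditiveSieve X) :
    R ∈ inducedCovers θ X ↔ ∀ (Q : C) (u : θ.obj X ⟶ Q),
      (∀ (Y : a) (f : Y ⟶ X), f ∈ R.homs Y → θ.map f ≫ u = 0) → u = 0 := by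
  constructor
  · rintro ⟨ι, Y, f, hf, hepi⟩ Q u hu
    exact (epi_sigmaDesc_iff _).1 hepi Q u fun i => hu _ _ (hf i)
  · intro h
    refine ⟨Σ i : SmallModel.{v} a, R.homs (smallObj a i), fun p => smallObj a p.1,
      fun p => p.2.1, fun p => p.2.2, (epi_sigmaDesc_iff _).2 fun Q u hu => h Q u fun Y f hf => ?_⟩
    obtain ⟨i, ⟨e⟩⟩ := exists_iso_smallObj Y
    rw [← Category.id_comp f, ← e.hom_inv_id, Category.assoc, Functor.map_comp, Category.assoc,
      hu ⟨i, e.inv ≫ f, R.comp_mem hf _⟩, comp_zero]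

lemma inducedCovers_eq_of_iso {θ θ' : a ⥤ C} (e : θ ≅ θ') (X : a) :
    inducedCovers θ X = inducedCovers θ' X := by
  ext R
  rw [mem_inducedCovers_iff, mem_inducedCovers_iff]
  constructor
  · intro h Q u hu
    rw [← cancel_epi (e.hom.app X), comp_zero]
    exact h Q _ fun Y f hf => by rw [NatTrans.naturality_assoc, hu Y f hf, comp_zero]
  · intro h Q u hu
    rw [← cancel_epi (e.inv.app X), comp_zero]
    exact h Q _ fun Y f hf => by rw [NatTrans.naturality_assoc, hu Y f hf, comp_zero]

end InducedCovers

/-! ### Exactness of sheafification and the topology of `Z` -/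

section Sheafification

variable {a : Type u} [Category.{v} a] [Preadditive a] [EssentiallySmall.{v} a]
  (T : AdditiveTopology a)

/-- Locally the section comes from the presheaf kernel; there its image in `F` is locally zero,
hence so is the section itself. -/
lemma sheafification_map_kernel_ι_injective {F G : PSh a} (f : F ⟶ G) (X : a) :
    Function.Injective (PSh.app ((sheafification T).map (kernel.ι f)).hom X) := by
  rw [injective_iff_map_eq_zero]
  intro z hz
  refine ((sheafification T).obj (kernel f)).property.eq_zero
    ((isBicovering_toSheafification T (kernel f)).coker X z) fun Y g ⟨k, hk⟩ => ?_
  rw [← hk]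
  have h : PSh.app (toSheafification T F) Y (PSh.app (kernel.ι f) Y k) = 0 := by
    rw [← PSh.app_comp, toSheafification_naturality, PSh.app_comp, hk, PSh.app_res, hz, map_zero]
  refine ((sheafification T).obj (kernel f)).property.eq_zero
    ((isBicovering_toSheafification T F).ker Y _ h) fun Z g hg => ?_
  rw [SubPSh.mem_sieve_bot, ← PSh.app_res] at hg
  rw [← PSh.app_res, PSh.app_injective_of_mono (kernel.ι f) Z (hg.trans (map_zero _).symm),
    map_zero]

/-- Locally `s` comes from a section `y` of `F` with `f y` locally zero, so `s` lies locally in the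
sheafified kernel, and this subsheaf contains what lies locally in it. -/
lemma exists_sheafification_map_kernel_ι {F G : PSh a} (f : F ⟶ G) {X : a}
    (s : ((sheafification T).obj F).obj.sec X)
    (hs : PSh.app ((sheafification T).map f).hom X s = 0) :
    ∃ z, PSh.app ((sheafification T).map (kernel.ι f)).hom X z = s := by
  refine ((sheafification T).obj (kernel f)).property.mem_range_of_locally
    ((sheafification T).obj F).property _ (sheafification_map_kernel_ι_injective T f) s ?_
  refine T.sieve_mem_of_local ((isBicovering_toSheafification T F).coker X s)
    fun Y g ⟨y, hy⟩ => ?_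
  have h : PSh.app (toSheafification T G) Y (PSh.app f Y y) = 0 := by
    rw [← PSh.app_comp, toSheafification_naturality, PSh.app_comp, hy, PSh.app_res, hs, map_zero]
  refine T.mem_of_le ((isBicovering_toSheafification T G).ker Y _ h) fun Z g' hg' => ?_
  rw [SubPSh.mem_sieve_bot, ← PSh.app_res] at hg'
  have hk : PSh.ofSec (F.res g' y) ≫ f = 0 := by rw [PSh.ofSec_comp, hg', PSh.ofSec_zero]
  refine ⟨PSh.app (toSheafification T (kernel f)) Z (PSh.toSec (kernel.lift f _ hk)), ?_⟩
  rw [← PSh.app_comp, ← toSheafification_naturality, PSh.app_comp, ← PSh.toSec_comp,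
    kernel.lift_ι, PSh.toSec_ofSec, PSh.app_res, hy]

/-- Sheaves form a reflective subcategory of presheaves. -/
instance : Reflective (shInclusion T) where
  L := sheafification T
  adj := sheafificationAdjunction T

instance : HasColimitsOfSize.{v, v} (Sh T) := hasColimits_of_reflective (shInclusion T)

instance : HasLimitsOfSize.{v, v} (Sh T) := hasLimits_of_reflective (shInclusion T)

instance : HasFiniteProducts (Sh T) := hasFiniteProducts_of_hasProducts.{v} (Sh T)

instance : HasZeroObject (Sh T) := hasZeroObject_of_hasInitial_object

instance preservesFiniteLimits_sheafification : PreservesFiniteLimits (sheafification T) := by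
  have : ∀ {F G : PSh a} (f : F ⟶ G), PreservesLimit (parallelPair f 0) (sheafification T) := by
    intro F G f
    have : Mono ((sheafification T).map (kernel.ι f)) :=
      ⟨fun α β h => ObjectProperty.hom_ext _ (PSh.hom_ext fun X x =>
        sheafification_map_kernel_ι_injective T f X
          (congrArg (fun α => PSh.app α.hom X x) h))⟩
    refine preservesLimit_of_preserves_limit_cone (kernelIsKernel f)
      ((KernelFork.isLimitMapConeEquiv _ _).symm ?_)
    refine KernelFork.IsLimit.ofι' ((sheafification T).map (kernel.ι f))
      (by rw [← Functor.map_comp, kernel.condition, Functor.map_zero]) fun {A} k hk => ?_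
    have h := PSh.exists_lift _ (sheafification_map_kernel_ι_injective T f) k.hom fun X x =>
      exists_sheafification_map_kernel_ι T f _
        (congrArg (fun α => PSh.app α.hom X x) hk)
    exact ⟨ObjectProperty.homMk h.choose, ObjectProperty.hom_ext _ h.choose_spec⟩
  exact Functor.preservesFiniteLimits_of_preservesKernels _

/-- The category of sheaves is abelian. -/
lemma exists_abelian_sh :
    ∃ A : Abelian (Sh T), A.toPreadditive = (inferInstance : Preadditive (Sh T)) :=
  ⟨abelianOfAdjunction (shInclusion T) (sheafification T)
    (asIso (sheafificationAdjunction T).counit) (sheafificationAdjunction T), rfl⟩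

variable {T}

/-- The section of a sheaf `G` over `X` which corresponds to a morphism from the sheafified
representable presheaf. -/
def shSec {X : a} {G : Sh T} (u : (yonedaSh T).obj X ⟶ G) : G.obj.sec X :=
  PSh.toSec (toSheafification T ((yonedaPSh a).obj X) ≫
    InducedCategory.Hom.hom (X := (sheafification T).obj ((yonedaPSh a).obj X)) u)

lemma shSec_zero {X : a} {G : Sh T} : shSec (0 : (yonedaSh T).obj X ⟶ G) = 0 :=
  congrArg PSh.toSec (comp_zero (f := toSheafification T ((yonedaPSh a).obj X)))

lemma shSec_injective {X : a} {G : Sh T} :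
    Function.Injective (shSec : ((yonedaSh T).obj X ⟶ G) → G.obj.sec X) := fun u w h => by
  apply sheafification_hom_ext T (F := (yonedaPSh a).obj X)
  rw [← PSh.ofSec_toSec (toSheafification T _ ≫ _)]
  exact (congrArg PSh.ofSec h).trans (PSh.ofSec_toSec _)

lemma exists_shSec_eq {X : a} {G : Sh T} (x : G.obj.sec X) :
    ∃ u : (yonedaSh T).obj X ⟶ G, shSec u = x := by
  obtain ⟨u, hu⟩ := exists_sheafification_desc T G (PSh.ofSec x)
  exact ⟨u, (congrArg PSh.toSec hu).trans (PSh.toSec_ofSec x)⟩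

lemma shSec_map_comp {X Y : a} {G : Sh T} (f : Y ⟶ X) (u : (yonedaSh T).obj X ⟶ G) :
    shSec ((yonedaSh T).map f ≫ u) = G.obj.res f (shSec u) := by
  apply PSh.ofSec_injective
  rw [← PSh.map_comp_ofSec, shSec, shSec, PSh.ofSec_toSec, PSh.ofSec_toSec]
  have := toSheafification_naturality T ((yonedaPSh a).map f)
  exact (Category.assoc _ _ _).symm.trans
    ((congrArg (fun h => h ≫ InducedCategory.Hom.hom
      (X := (sheafification T).obj ((yonedaPSh a).obj X)) u) this.symm).trans
        (Category.assoc _ _ _))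

lemma shSec_eq_zero_iff {X : a} {G : Sh T} (u : (yonedaSh T).obj X ⟶ G) : shSec u = 0 ↔ u = 0 :=
  ⟨fun h => shSec_injective (h.trans shSec_zero.symm), fun h => h ▸ shSec_zero⟩

variable (T)

lemma inducedCovers_yonedaSh (X : a) : inducedCovers (yonedaSh T) X = T.covers X := by
  ext R
  rw [mem_inducedCovers_iff]
  constructor
  · intro hR
    let S : SubPSh ((yonedaPSh a).obj X) := SubPSh.range R.incl
    -- The class of the identity in `a(-, X)/R`: its annihilator is exactly `R`. Its image in the
    -- sheafification is killed by `R`, hence zero by hypothesis, so `x` vanishes locally and `R` is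
    -- covering.
    let x := PSh.toSec S.proj
    obtain ⟨u, hu⟩ := exists_shSec_eq (G := (sheafification T).obj S.quot)
      (PSh.app (toSheafification T S.quot) X x)
    have hxf : ∀ {Z : a} (g : Z ⟶ X), S.quot.res g x = 0 ↔ g ∈ R.homs Z := fun {Z} g => by
      rw [← PSh.app_eq_res_toSec]
      refine (S.proj_eq_zero_iff _).trans ⟨?_, fun h => ⟨⟨g, h⟩, rfl⟩⟩
      rintro ⟨g, rfl⟩
      exact g.2
    have hu' := hR _ u fun Y f hf => by
      rw [← shSec_eq_zero_iff, shSec_map_comp, hu, ← PSh.app_res, (hxf _).2 hf, map_zero]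
    rw [← shSec_eq_zero_iff, hu] at hu'
    exact T.mem_of_le ((isBicovering_toSheafification T _).ker X x hu') fun Z g hg => (hxf g).1 hg
  · intro hR G u hu
    rw [← shSec_eq_zero_iff]
    exact G.property.eq_zero hR fun Y f hf => by rw [← shSec_map_comp, hu Y f hf, shSec_zero]

lemma prexactWithTopology_yonedaSh : prexactWithTopology T (Sh T) (yonedaSh T) := by
  refine ⟨⟨?_, sheafification T, ⟨inferInstance, ⟨Iso.refl _⟩⟩, inferInstance⟩,
    inducedCovers_yonedaSh T⟩
  have : (yonedaPSh a).Additive := ⟨fun {X Y f g} => PSh.hom_ext fun Z h =>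
    Preadditive.comp_add _ _ _ h f g⟩
  unfold yonedaSh
  infer_instance

end Sheafification

/-! ### Cocontinuous functors on presheaves -/

section Cocontinuous

variable {a : Type u} [Category.{v} a] [Preadditive a] {C : Type w₁} [Category.{w₁'} C]

lemma additive_of_preservesColimits [Abelian C] (Θ : PSh a ⥤ C)
    [PreservesColimitsOfSize.{v, v} Θ] : Θ.Additive :=
  rightExactFunctor_le_additiveFunctor (PSh a) C Θ
    (PreservesColimitsOfSize.preservesFiniteColimits.{v, v} Θ)

variable [EssentiallySmall.{v} a]

lemma epi_sigmaDesc_ofSec (P : PSh a) :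
    Epi (Sigma.desc fun q : Σ i : SmallModel.{v} a, P.sec (smallObj a i) => PSh.ofSec q.2) := by
  rw [epi_sigmaDesc_iff]
  refine fun Q u hu => PSh.hom_ext fun X x => ?_
  obtain ⟨i, ⟨e⟩⟩ := exists_iso_smallObj X
  have := hu ⟨i, P.res e.inv x⟩
  rw [PSh.ofSec_comp, ← PSh.ofSec_zero] at this
  rw [← P.res_id x, ← e.hom_inv_id, ← P.res_res, PSh.app_res, PSh.ofSec_injective this, map_zero,
    PSh.app_zero]

variable (Θ : PSh a ⥤ C) [PreservesColimitsOfSize.{v, v} Θ]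

/-- A cocontinuous functor sends the sections of a presheaf to a jointly epimorphic family. -/
lemma cocontinuous_hom_ext {P : PSh a} {Q : C} {u w : Θ.obj P ⟶ Q}
    (h : ∀ (X : a) (x : P.sec X), Θ.map (PSh.ofSec x) ≫ u = Θ.map (PSh.ofSec x) ≫ w) : u = w := by
  have := epi_sigmaDesc_ofSec P
  have := PreservesColimitsOfSize.preservesFiniteColimits.{v, v} Θ
  rw [← cancel_epi (Θ.map (Sigma.desc fun q : Σ i : SmallModel.{v} a, P.sec (smallObj a i) =>
    PSh.ofSec q.2))]
  refine (isColimitOfPreserves Θ (coproductIsCoproduct _)).hom_ext fun ⟨q⟩ => ?_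
  change Θ.map (Sigma.ι _ q) ≫ _ = Θ.map (Sigma.ι _ q) ≫ _
  rw [← Functor.map_comp_assoc, ← Functor.map_comp_assoc, Sigma.ι_desc]
  exact h _ q.2

lemma natTrans_ext_of_yoneda {Θ' : PSh a ⥤ C} {β γ : Θ ⟶ Θ'}
    (h : Functor.whiskerLeft (yonedaPSh a) β = Functor.whiskerLeft (yonedaPSh a) γ) : β = γ := by
  ext P
  refine cocontinuous_hom_ext Θ fun X x => ?_
  rw [β.naturality, γ.naturality]
  exact congrArg (· ≫ _) (NatTrans.congr_app h X)

variable [Abelian C]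

/-- The value of a cocontinuous functor at `P` represents the natural additive families of
morphisms indexed by the sections of `P`. -/
lemma exists_cocontinuous_desc {P : PSh a} {Q : C}
    (u : ∀ X : a, P.sec X →+ (Θ.obj ((yonedaPSh a).obj X) ⟶ Q))
    (hu : ∀ (X Y : a) (f : Y ⟶ X) (x : P.sec X),
      Θ.map ((yonedaPSh a).map f) ≫ u X x = u Y (P.res f x)) :
    ∃ U : Θ.obj P ⟶ Q, ∀ (X : a) (x : P.sec X), Θ.map (PSh.ofSec x) ≫ U = u X x := by
  have := additive_of_preservesColimits Θ
  have := PreservesColimitsOfSize.preservesFiniteColimits.{v, v} Θ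
  let y (q : Σ i : SmallModel.{v} a, P.sec (smallObj a i)) : PSh a :=
    (yonedaPSh a).obj (smallObj a q.1)
  let G : PSh a := ∐ y
  let p : G ⟶ P := Sigma.desc fun q => PSh.ofSec q.2
  have : Epi p := epi_sigmaDesc_ofSec P
  obtain ⟨U₀, hU₀⟩ : ∃ U₀ : Θ.obj G ⟶ Q, ∀ q, Θ.map (Sigma.ι y q) ≫ U₀ = u _ q.2 := by
    let hG := isColimitOfPreserves Θ (coproductIsCoproduct y)
    let s : Cocone (Discrete.functor y ⋙ Θ) :=
      { pt := Q
        ι := Discrete.natTrans fun q => u _ q.as.2 }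
    exact ⟨hG.desc s, fun q => hG.fac s ⟨q⟩⟩
  -- The sections of `G` on which `U₀` takes the value prescribed by `u`. They include the
  -- generators of the coproduct, so they are all of `G`.
  let N : SubPSh G :=
    { sub := fun X =>
        { carrier := {z | Θ.map (PSh.ofSec z) ≫ U₀ = u X (PSh.app p X z)}
          zero_mem' := by simp
          add_mem' := fun {z w} hz hw => by
            simp only [Set.mem_ofPred_eq] at hz hw ⊢
            rw [PSh.ofSec_add, Functor.map_add, Preadditive.add_comp, hz, hw, map_add, map_add]
          neg_mem' := fun {z} hz => by
            simp only [Set.mem_ofPred_eq] at hz ⊢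
            rw [PSh.ofSec_neg, Functor.map_neg, Preadditive.neg_comp, hz, map_neg, map_neg] }
      res_mem := fun {X Y} f z hz => by
        change Θ.map (PSh.ofSec (G.res f z)) ≫ U₀ = u Y (PSh.app p Y (G.res f z))
        rw [PSh.app_res, ← hu, ← PSh.map_comp_ofSec, Functor.map_comp, Category.assoc]
        exact congrArg _ hz }
  have hN : N.proj = 0 := by
    refine Sigma.hom_ext _ _ fun q => ?_
    rw [comp_zero, ← PSh.ofSec_toSec (Sigma.ι y q), PSh.ofSec_comp, ← PSh.ofSec_zero]
    refine congrArg _ ((N.proj_eq_zero_iff _).2 ?_)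
    change Θ.map (PSh.ofSec _) ≫ U₀ = u _ (PSh.app p _ (PSh.toSec (Sigma.ι y q)))
    rw [PSh.ofSec_toSec, hU₀, ← PSh.toSec_comp, Sigma.ι_desc, PSh.toSec_ofSec]
  have hN' : ∀ (X : a) (z : G.sec X), Θ.map (PSh.ofSec z) ≫ U₀ = u X (PSh.app p X z) := fun X z =>
    (N.proj_eq_zero_iff z).1 (by rw [hN, PSh.app_zero])
  -- Since `p` is the cokernel of its kernel and `Θ` preserves cokernels, this lets `U₀` descend to
  -- `Θ.obj P`.
  have hU₀' : Θ.map (kernel.ι p) ≫ U₀ = 0 := by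
    refine cocontinuous_hom_ext Θ fun X z => ?_
    rw [← Functor.map_comp_assoc, PSh.ofSec_comp, hN', ← PSh.app_comp, kernel.condition,
      PSh.app_zero, map_zero, comp_zero]
  let hp := CokernelCofork.mapIsColimit _ (Abelian.epiIsCokernelOfKernel _ (kernelIsKernel p)) Θ
  obtain ⟨U, hU⟩ : ∃ U, Θ.map p ≫ U = U₀ :=
    ⟨_, (CokernelCofork.IsColimit.desc' hp U₀ hU₀').2⟩
  have key : ∀ (i : SmallModel.{v} a) (x : P.sec (smallObj a i)),
      Θ.map (PSh.ofSec x) ≫ U = u _ x := fun i x => by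
    rw [← hU₀ ⟨i, x⟩, ← hU, ← Functor.map_comp_assoc, Sigma.ι_desc]
  refine ⟨U, fun X x => ?_⟩
  obtain ⟨i, ⟨e⟩⟩ := exists_iso_smallObj X
  rw [← P.res_id x, ← e.hom_inv_id, ← P.res_res, ← hu, ← key, ← PSh.map_comp_ofSec,
    Functor.map_comp, Category.assoc]

/-- A natural transformation between restrictions to representable presheaves extends to
presheaves. -/
lemma exists_natTrans_extension (Θ' : PSh a ⥤ C) [Θ'.Additive]
    (α : yonedaPSh a ⋙ Θ ⟶ yonedaPSh a ⋙ Θ') :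
    ∃ β : Θ ⟶ Θ', Functor.whiskerLeft (yonedaPSh a) β = α := by
  have key : ∀ P : PSh a, ∃ U : Θ.obj P ⟶ Θ'.obj P, ∀ (X : a) (x : P.sec X),
      Θ.map (PSh.ofSec x) ≫ U = α.app X ≫ Θ'.map (PSh.ofSec x) := fun P =>
    exists_cocontinuous_desc Θ
      (fun X => { toFun := fun x => α.app X ≫ Θ'.map (PSh.ofSec x)
                  map_zero' := by simp
                  map_add' := fun x y => by
                    rw [PSh.ofSec_add, Functor.map_add, Preadditive.comp_add] })
      (fun X Y f x => by
        have := α.naturality f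
        simp only [Functor.comp_map] at this
        simp only [AddMonoidHom.coe_mk, ZeroHom.coe_mk]
        rw [reassoc_of% this, ← PSh.map_comp_ofSec, Functor.map_comp])
  choose U hU using key
  refine ⟨{ app := U, naturality := fun P P' f => cocontinuous_hom_ext Θ fun X x => ?_ }, ?_⟩
  · rw [← Functor.map_comp_assoc, PSh.ofSec_comp, hU, reassoc_of% (hU P X x), ← PSh.ofSec_comp,
      Functor.map_comp]
  · ext X
    have := hU ((yonedaPSh a).obj X) X (PSh.toSec (𝟙 _))
    rw [PSh.ofSec_toSec] at this
    simpa using this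

end Cocontinuous

/-- The colimit of `K` is the reflection of the colimit of `K ⋙ R`, and `L ⋙ F` preserves the
latter. -/
lemma preservesColimitsOfSize_of_reflective {C : Type*} [Category* C] {D : Type*} [Category* D]
    {E : Type*} [Category* E] {L : D ⥤ C} {R : C ⥤ D} [R.Full] [R.Faithful] (adj : L ⊣ R)
    [HasColimitsOfSize.{v, v} D] (F : C ⥤ E) [PreservesColimitsOfSize.{v, v} (L ⋙ F)] :
    PreservesColimitsOfSize.{v, v} F where
  preservesColimitsOfShape {J _} :=
    { preservesColimit := fun {K} => by
        have := adj.leftAdjoint_preservesColimits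
        have : PreservesColimit ((K ⋙ R) ⋙ L) F :=
          preservesColimit_of_preserves_colimit_cocone
            (isColimitOfPreserves L (colimit.isColimit (K ⋙ R)))
            (isColimitOfPreserves (L ⋙ F) (colimit.isColimit (K ⋙ R)))
        exact preservesColimit_of_iso_diagram F (K₁ := (K ⋙ R) ⋙ L)
          (Functor.associator K R L ≪≫ Functor.isoWhiskerLeft K (asIso adj.counit) ≪≫
            K.rightUnitor) }

/-! ### Descent of an exact extension to sheaves -/

section Extension

variable {a : Type u} [Category.{v} a] [Preadditive a] [EssentiallySmall.{v} a]
  {T : AdditiveTopology a} {C : Type w₁} [Category.{w₁'} C] [Abelian C]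
  [HasColimitsOfSize.{v, v} C] {Θ : PSh a ⥤ C}

lemma hom_eq_zero_of_cover (hT : ∀ X : a, inducedCovers (yonedaPSh a ⋙ Θ) X = T.covers X)
    {X : a} {R : AdditiveSieve X} (hR : R ∈ T.covers X) {P : PSh a} (x : P.sec X) {Q : C}
    (u : Θ.obj P ⟶ Q)
    (h : ∀ (Y : a) (f : Y ⟶ X), f ∈ R.homs Y → Θ.map (PSh.ofSec (P.res f x)) ≫ u = 0) :
    Θ.map (PSh.ofSec x) ≫ u = 0 := by
  rw [← hT, mem_inducedCovers_iff] at hR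
  refine hR Q _ fun Y f hf => ?_
  rw [Functor.comp_map, ← Functor.map_comp_assoc, PSh.map_comp_ofSec, h Y f hf]

variable [PreservesColimitsOfSize.{v, v} Θ] [PreservesFiniteLimits Θ]

/-- An exact extension inverts the morphisms which are locally bijective for the induced
topology. -/
lemma isIso_map_of_isBicovering
    (hT : ∀ X : a, inducedCovers (yonedaPSh a ⋙ Θ) X = T.covers X) {F N : PSh a} {c : F ⟶ N}
    (hc : IsBicovering T c) : IsIso (Θ.map c) := by
  have := additive_of_preservesColimits Θ
  -- Sections of the kernel vanish locally in `F`, so `Θ` kills them; left exactness then makes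
  -- `Θ.map c` a monomorphism.
  have hk : Θ.map (kernel.ι c) = 0 := cocontinuous_hom_ext Θ fun X z => by
    rw [← Functor.map_comp, PSh.ofSec_comp, comp_zero, ← Category.comp_id (Θ.map _)]
    refine hom_eq_zero_of_cover hT (hc.ker X (PSh.app (kernel.ι c) X z) ?_) _ _ fun Y f hf => ?_
    · rw [← PSh.app_comp, kernel.condition, PSh.app_zero]
    · rw [(SubPSh.mem_sieve_bot _ _).1 hf, PSh.ofSec_zero, Functor.map_zero, zero_comp]
  have : Mono (Θ.map c) := Preadditive.mono_of_cancel_zero _ fun {A} g hg => by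
    obtain ⟨l, hl⟩ := KernelFork.IsLimit.lift'
      (KernelFork.mapIsLimit _ (kernelIsKernel c) Θ) g hg
    rw [← hl]
    exact (congrArg (l ≫ ·) hk).trans comp_zero
  have : Epi (Θ.map c) := Preadditive.epi_of_cancel_zero _ fun {Q} u hu =>
    cocontinuous_hom_ext Θ fun X n => by
      rw [comp_zero]
      refine hom_eq_zero_of_cover hT (hc.coker X n) n u fun Y f ⟨y, hy⟩ => ?_
      rw [← hy, ← PSh.ofSec_comp, Functor.map_comp, Category.assoc, hu, comp_zero]
  exact isIso_of_mono_of_epi _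

/-- The kernel of `y : a(-, X) ⟶ P` is the annihilator sieve of `y`. By left exactness `Θ` sends its
inclusion to a kernel of zero, which is a split epimorphism, so the annihilator is covering for `θ`.
-/
lemma sieve_mem_covers_of_map_ofSec_eq_zero
    (hT : ∀ X : a, inducedCovers (yonedaPSh a ⋙ Θ) X = T.covers X) {P : PSh a} {X : a}
    (y : P.sec X) (hy : Θ.map (PSh.ofSec y) = 0) : (SubPSh.bot P).sieve y ∈ T.covers X := by
  rw [← hT, mem_inducedCovers_iff]
  intro Q (u : Θ.obj ((yonedaPSh a).obj X) ⟶ Q) hu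
  have := additive_of_preservesColimits Θ
  obtain ⟨l, hl⟩ := KernelFork.IsLimit.lift'
    (KernelFork.mapIsLimit _ (kernelIsKernel (PSh.ofSec y)) Θ) (𝟙 _) (by rw [hy, comp_zero])
  have hk : Θ.map (kernel.ι (PSh.ofSec y)) ≫ u = 0 := cocontinuous_hom_ext Θ fun Y k => by
    obtain ⟨f, hf⟩ : ∃ f : Y ⟶ X, (yonedaPSh a).map f = PSh.ofSec k ≫ kernel.ι (PSh.ofSec y) :=
      ⟨_, PSh.yonedaPSh_map_toSec _⟩
    have hfy : P.res f y = 0 := by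
      apply PSh.ofSec_injective
      rw [← PSh.map_comp_ofSec, hf, Category.assoc, kernel.condition, comp_zero, PSh.ofSec_zero]
    have := hu Y f hfy
    rwa [Functor.comp_map, hf, Functor.map_comp, Category.assoc,
      ← comp_zero (f := Θ.map (PSh.ofSec k))] at this
  rw [← Category.id_comp u, ← hl, Category.assoc]
  exact (congrArg (l ≫ ·) hk).trans comp_zero

lemma isFaithfulExactCocontinuous_shInclusion_comp
    (hT : ∀ X : a, inducedCovers (yonedaPSh a ⋙ Θ) X = T.covers X) :
    IsFaithfulExactCocontinuous.{v} (shInclusion T ⋙ Θ) ∧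
      Nonempty (sheafification T ⋙ shInclusion T ⋙ Θ ≅ Θ) := by
  have := additive_of_preservesColimits Θ
  have (P : PSh a) : IsIso (Θ.map ((sheafificationAdjunction T).unit.app P)) :=
    isIso_map_of_isBicovering hT (isBicovering_toSheafification T P)
  let e : Θ ≅ sheafification T ⋙ shInclusion T ⋙ Θ :=
    NatIso.ofComponents
      (fun P => asIso (Θ.map ((sheafificationAdjunction T).unit.app P))) fun {P P'} f => by
        have := (sheafificationAdjunction T).unit.naturality f
        simp only [asIso_hom, Functor.comp_map, ← Functor.map_comp]
        exact congrArg Θ.map this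
  have : PreservesColimitsOfSize.{v, v} (sheafification T ⋙ shInclusion T ⋙ Θ) :=
    preservesColimits_of_natIso e
  have hΘ := preservesColimitsOfSize_of_reflective (sheafificationAdjunction T) (shInclusion T ⋙ Θ)
  have : PreservesLimitsOfSize.{0, 0} (shInclusion T) :=
    (sheafificationAdjunction T).rightAdjoint_preservesLimits
  refine ⟨⟨⟨fun {G H} f g hfg => ?_⟩, inferInstance,
    PreservesColimitsOfSize.preservesFiniteColimits.{v, v} _, hΘ⟩, ⟨e.symm⟩⟩
  refine ObjectProperty.hom_ext _ (PSh.hom_ext fun X x => sub_eq_zero.1 ?_)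
  -- Faithfulness: `Θ` kills the section `(f - g)(x)` of `H`, so it vanishes locally, hence
  -- vanishes.
  refine H.property.eq_zero (sieve_mem_covers_of_map_ofSec_eq_zero hT _ ?_) fun Y f hf => hf
  have h : Θ.map f.hom = Θ.map g.hom := hfg
  rw [sub_eq_add_neg, PSh.ofSec_add, PSh.ofSec_neg, ← PSh.ofSec_comp, ← PSh.ofSec_comp,
    Functor.map_add, Functor.map_neg, Functor.map_comp, Functor.map_comp, h, add_neg_cancel]

end Extension

/-! ### The universal property of `Z` -/

section Universal

variable {a : Type u} [Category.{v} a] [Preadditive a] [EssentiallySmall.{v} a]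
  (T : AdditiveTopology a) (C : Type w₁) [Category.{w₁'} C] [Abelian C]
  [HasColimitsOfSize.{v, v} C]

/-- Composition with the sheafified Yoneda embedding. -/
abbrev compYonedaSh : AB3Functor.{v} (Sh T) C ⥤ PrexFunctor T C :=
  (prexPostcomp T (Sh T) C).flip.obj ⟨yonedaSh T, prexactWithTopology_yonedaSh T⟩

/-- Restriction along `Z` is restriction along the localization `sheafification T`, then to
representables; both steps are faithful here. -/
instance : (compYonedaSh T C).Faithful where
  map_injective {F G} α β h := by
    have := F.property.cocontinuous
    have := (sheafificationAdjunction T).isLocalization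
    have := Localization.faithful_whiskeringLeft (sheafification T)
      ((MorphismProperty.isomorphisms _).inverseImage (sheafification T)) C
    refine ObjectProperty.hom_ext _
      (((Functor.whiskeringLeft _ _ C).obj (sheafification T)).map_injective ?_)
    refine natTrans_ext_of_yoneda (sheafification T ⋙ F.obj) ?_
    exact congrArg (fun γ => γ.hom) h

instance : (compYonedaSh T C).Full where
  map_surjective {F G} α := by
    have := F.property.cocontinuous
    have := G.property.additive
    have := (sheafificationAdjunction T).isLocalization
    have := Localization.full_whiskeringLeft (sheafification T)
      ((MorphismProperty.isomorphisms _).inverseImage (sheafification T)) C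
    obtain ⟨β, hβ⟩ := exists_natTrans_extension (sheafification T ⋙ F.obj)
      (sheafification T ⋙ G.obj) α.hom
    obtain ⟨γ, hγ⟩ := ((Functor.whiskeringLeft _ _ C).obj (sheafification T)).map_surjective β
    refine ⟨ObjectProperty.homMk γ, ObjectProperty.hom_ext _ ?_⟩
    rw [← hβ, ← hγ]
    rfl

instance : (compYonedaSh T C).EssSurj where
  mem_essImage θ := by
    obtain ⟨θ, ⟨_, Θ, ⟨_, ⟨e⟩⟩, _⟩, hT⟩ := θ
    -- The preimage of `θ` is the restriction to sheaves of its exact extension.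
    obtain ⟨h, ⟨e'⟩⟩ := isFaithfulExactCocontinuous_shInclusion_comp (T := T) (Θ := Θ) fun X => by
      rw [inducedCovers_eq_of_iso e, hT]
    exact ⟨⟨_, h⟩, ⟨ObjectProperty.isoMk _
      ((Functor.isoWhiskerLeft (yonedaPSh a) e').trans e)⟩⟩

end Universal

end AdditiveSheaf

end

open AdditiveSheaf
theorem mainTheorem3 {a : Type u} [Category.{v} a] [Preadditive a] [EssentiallySmall.{v} a]
    (T : AdditiveTopology a) :
    (∃ A : Abelian (Sh T), A.toPreadditive = (inferInstance : Preadditive (Sh T))) ∧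
    ∃ (_ : HasColimitsOfSize.{v, v} (Sh T)) (_ : (shInclusion T).IsRightAdjoint)
      (hZ : prexactWithTopology T (Sh T) (yonedaSh T)),
      ∀ (C : Type w₁) [Category.{w₁'} C] [Abelian C] [HasColimitsOfSize.{v, v} C],
        ((prexPostcomp T (Sh T) C).flip.obj ⟨yonedaSh T, hZ⟩).IsEquivalence :=
  ⟨exists_abelian_sh T, inferInstance, inferInstance,
    prexactWithTopology_yonedaSh T, fun C _ _ _ =>
      { faithful := inferInstanceAs (compYonedaSh T C).Faithful
        full := inferInstanceAs (compYonedaSh T C).Full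
        essSurj := inferInstanceAs (compYonedaSh T C).EssSurj }⟩
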